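/- Let $n$ and $k$ be integers with $1\le k\le n-1$ and $k\notin\{n/3,2n/3\}$, let $q=2^n$ and $d=\gcd(n,k)$, and assume that $n/d$ is odd. Let $\mathrm{Tr}:\mathbb{F}_q\to\mathbb{F}_2$ be the absolute trace and let $\pi$ be a primitive element of $\mathbb{F}_q$. For $\alpha,\beta,\gamma\in\mathbb{F}_q$ put $$S(\alpha,\beta,\gamma)=\sum_{x\in\mathbb{F}_q}(-1)^{\mathrm{Tr}(\alpha x^{2^{2k}+1}+\beta x^{2^k+1}+\gamma x)}$$ and let $c(\alpha,\beta,\gamma)\in\mathbb{F}_2^{\,q-1}$ be the word whose $i$-th entry is $\mathrm{Tr}(\alpha\pi^{i(2^{2k}+1)}+\beta\pi^{i(2^k+1)}+\gamma\pi^i)$, $0\le i\le q-2$. Let $h_1,h_2,h_3$ be the minimal polynomials over $\mathbb{F}_2$ of $\pi^{-1}$, $\pi^{-(2^k+1)}$, $\pi^{-(2^{2k}+1)}$. Then $h_1h_2h_3$ divides $X^{q-1}-1$. Let $\mathcal{C}$ be the binary cyclic code of length $q-1$ with parity-check polynomial $h_1h_2h_3$, that is, the set of all $(c_0,\dots,c_{q-2})\in\mathbb{F}_2^{\,q-1}$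 such that $X^{q-1}-1$ divides $(c_0+c_1X+\dots+c_{q-2}X^{q-2})\,h_1h_2h_3$. Then $(\alpha,\beta,\gamma)\mapsto c(\alpha,\beta,\gamma)$ is a bijection from $\mathbb{F}_q^3$ onto $\mathcal{C}$, and the Hamming weight of $c(\alpha,\beta,\gamma)$ is $2^{n-1}-\frac12 S(\alpha,\beta,\gamma)$. The value distribution of $S(\alpha,\beta,\gamma)$, as $(\alpha,\beta,\gamma)$ ranges over $\mathbb{F}_q^3$, and the weight distribution of $\mathcal{C}$ are as follows. No other values of $S$ and no other weights of codewords of $\mathcal{C}$ occur. The multiplicity is both the number of triples $(\alpha,\beta,\gamma)$ for which $S$ takes the value and the number of codewords of $\mathcal{C}$ of the weight. $$\begin{array}{|c|c|c|}\hline \text{value}&\text{weight}&\text{multiplicity}\\ \hline 2^{(n+d)/2}&2^{n-1}-2^{(n+d-2)/2}&\frac{(2^{n-d-1}+2^{(n-d-2)/2})(2^n-1)(2^{n+2d}-2^n-2^{n-d}+2^{2d})}{2^{2d}-1}\\ -2^{(n+d)/2}&2^{n-1}+2^{(n+d-2)/2}&\frac{(2^{n-d-1}-2^{(n-d-2)/2})(2^n-1)(2^{n+2d}-2^n-2^{n-d}+2^{2d})}{2^{2d}-1}\\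 2^{(n+3d)/2}&2^{n-1}-2^{(n+3d-2)/2}&\frac{(2^{n-3d-1}+2^{(n-3d-2)/2})(2^{n-d}-1)(2^n-1)}{2^{2d}-1}\\ -2^{(n+3d)/2}&2^{n-1}+2^{(n+3d-2)/2}&\frac{(2^{n-3d-1}-2^{(n-3d-2)/2})(2^{n-d}-1)(2^n-1)}{2^{2d}-1}\\ 0&2^{n-1}&(2^n-1)(2^{2n}-2^{2n-d}+2^{2n-4d}+2^n-2^{n-d}-2^{n-3d}+1)\\ 2^n&0&1\\ \hline \end{array}$$ -/

import Mathlib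

open Polynomial

/-- The canonical additive character `x ↦ (-1) ^ Tr(x)` of a finite field `F` of characteristic 2,
where `Tr : F → 𝔽₂` is the absolute trace. -/
noncomputable def addChi {F : Type*} [Field F] [Algebra (ZMod 2) F] (x : F) : ℤ :=
  (-1) ^ (Algebra.trace (ZMod 2) F x).val

/-- The exponential sum
`S(α, β, γ) = ∑ x, (-1) ^ Tr(α x ^ (2 ^ (2k) + 1) + β x ^ (2 ^ k + 1) + γ x)`. -/
noncomputable def expSum {F : Type*} [Field F] [Fintype F] [Algebra (ZMod 2) F]
    (k : ℕ) (α β γ : F) : ℤ :=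
  ∑ x : F, addChi (α * x ^ (2 ^ (2 * k) + 1) + β * x ^ (2 ^ k + 1) + γ * x)

/-- The number of triples `(α, β, γ)` in `F³` with `S(α, β, γ) = v`. -/
noncomputable def valueMult (F : Type*) [Field F] [Fintype F] [Algebra (ZMod 2) F]
    (k : ℕ) (v : ℤ) : ℕ :=
  {t : F × F × F | expSum k t.1 t.2.1 t.2.2 = v}.ncard

/-- The polynomial `c₀ + c₁ X + ⋯ + c_{l-1} X ^ (l-1)` of a binary word of length `l`. -/
noncomputable def wordPoly (l : ℕ) (c : Fin l → ZMod 2) : (ZMod 2)[X] :=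
  ∑ i : Fin l, C (c i) * X ^ (i : ℕ)

/-- The binary cyclic code of length `l` with parity-check polynomial `h` (a divisor of
`X ^ l - 1`): the words `c` with `c(X) h(X) ≡ 0` modulo `X ^ l - 1`. -/
def cyclicCode (l : ℕ) (h : (ZMod 2)[X]) : Submodule (ZMod 2) (Fin l → ZMod 2) where
  carrier := {c | (X ^ l - 1 : (ZMod 2)[X]) ∣ wordPoly l c * h}
  zero_mem' := by simp [wordPoly]
  add_mem' := by
    intro a b ha hb
    have e : wordPoly l (a + b) = wordPoly l a + wordPoly l b := by
      simp [wordPoly, add_mul, Finset.sum_add_distrib]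
    simp only [Set.mem_ofPred_eq] at ha hb ⊢
    rw [e, add_mul]
    exact dvd_add ha hb
  smul_mem' := by
    intro r a ha
    have e : wordPoly l (r • a) = C r * wordPoly l a := by
      simp [wordPoly, Finset.mul_sum, mul_assoc]
    simp only [Set.mem_ofPred_eq] at ha ⊢
    rw [e, mul_assoc]
    exact Dvd.dvd.mul_left ha _

/-- The number of codewords of `𝒞` of Hamming weight `w`. -/
noncomputable def weightMult {l : ℕ} (𝒞 : Submodule (ZMod 2) (Fin l → ZMod 2)) (w : ℤ) : ℕ :=
  {c : Fin l → ZMod 2 | c ∈ 𝒞 ∧ (hammingNorm c : ℤ) = w}.ncard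

/-- The product `h₁ h₂ h₃` of the minimal polynomials over `𝔽₂` of `π⁻¹`, `π ^ (-(2 ^ k + 1))` and
`π ^ (-(2 ^ (2k) + 1))`. -/
noncomputable def checkPoly {F : Type*} [Field F] [Algebra (ZMod 2) F] (k : ℕ) (π : F) :
    (ZMod 2)[X] :=
  minpoly (ZMod 2) π⁻¹ * minpoly (ZMod 2) (π⁻¹ ^ (2 ^ k + 1)) *
    minpoly (ZMod 2) (π⁻¹ ^ (2 ^ (2 * k) + 1))

/-- The word `c(α, β, γ)` of length `l`, whose `i`-th entry (`0 ≤ i < l`) is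
`Tr(α π ^ (i (2 ^ (2k) + 1)) + β π ^ (i (2 ^ k + 1)) + γ π ^ i)`. -/
noncomputable def codeWord {F : Type*} [Field F] [Algebra (ZMod 2) F] (l k : ℕ) (π : F)
    (α β γ : F) : Fin l → ZMod 2 := fun i =>
  Algebra.trace (ZMod 2) F
    (α * π ^ ((i : ℕ) * (2 ^ (2 * k) + 1)) + β * π ^ ((i : ℕ) * (2 ^ k + 1)) + γ * π ^ (i : ℕ))

/-! Let σ be x ↦ x^(2^k), with fixed field K of order 2^d. For fixed (α, β) the function Tr(α x σ²x
+ β x σx) is a quadratic form over 𝔽₂, and `polarOp` is the K-linear operator L representing its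
polarization. Squaring the sum gives S² = q · Σ_{z ∈ ker L} (-1)^(Q(z) + Tr(γz)), where Q is the
form. The summand is a character of ker L, so S² is 0 or q·|ker L|. The first two moments over γ
then fix how often each of M, -M, 0 occurs, where M² = q·|ker L|.

The nullity of L over K is 1 or 3 when (α, β) ≠ 0. Indeed σ²L is a nonzero polynomial of degree at
most 4 in σ, so the nullity is at most 4 (`finrank_ker_sigmaPoly_le`). The form Tr_{F/K}(L(x)y) is
alternating, so its rank is even, while [F : K] = n/d is odd.

The numbers N₁, N₃ of pairs with each nullity come from counting the triples with L_{α,β}(x) = 0.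
Every x ≠ 0 is killed by exactly q·|K| pairs (`card_polarOp_apply_eq_zero`). This gives a linear
equation in N₁ and N₃, and N₁ + N₃ = q² - 1 is another. The excluded values of k force n/d ≥ 5,
which keeps the values in the table distinct.

For the code, S = q exactly once, so only the zero triple gives the zero word, and (α, β, γ) ↦ c(α,
β, γ) is injective. Its q³ words lie in the code, whose size is at most 2^deg(h₁h₂h₃) ≤ q³. The same
count applied to the least common multiple of the hᵢ shows that it has the full degree 3n. Hence
h₁h₂h₃ divides X^(q-1) - 1, with no discussion of cyclotomic cosets. -/

/-! ### Linear algebra: rank of alternating forms, nullity of a composition. -/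

/-- Splitting off a hyperbolic plane lowers the dimension by 2 and leaves the radical unchanged, so
induction applies. The characteristic may be 2. -/
theorem LinearMap.BilinForm.IsAlt.even_finrank_add_finrank_ker {K : Type*} [Field K] (m : ℕ) :
    ∀ {V : Type*} [AddCommGroup V] [Module K V] [FiniteDimensional K V]
      (B : LinearMap.BilinForm K V), B.IsAlt → Module.finrank K V = m →
      Even (Module.finrank K V + Module.finrank K (LinearMap.ker B)) := by
  induction m using Nat.strong_induction_on with
  | _ m ih =>
    intro V _ _ _ B hB hm
    by_cases h0 : B = 0
    · rw [h0, LinearMap.ker_zero, finrank_top]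
      exact ⟨_, rfl⟩
    · obtain ⟨v, w, hvw⟩ : ∃ v w, B v w = 1 := by
        by_contra! hne
        refine h0 (LinearMap.ext₂ fun v w => ?_)
        by_contra hvw
        refine hne v ((B v w)⁻¹ • w) ?_
        simpa using inv_mul_cancel₀ hvw
      have hwv : B w v = -1 := by rw [← hB.neg_eq, hvw]
      let φ : V →ₗ[K] K × K := (B v).prod (B w)
      have hφ : LinearMap.range φ = ⊤ := by
        refine LinearMap.range_eq_top.2 fun p => ⟨p.1 • w - p.2 • v, ?_⟩
        ext
        · simp [φ, hvw, hB.self_eq_zero]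
        · simp [φ, hwv, hB.self_eq_zero]
      have hrank := LinearMap.finrank_range_add_finrank_ker φ
      rw [hφ, finrank_top, Module.finrank_prod, Module.finrank_self] at hrank
      let W := LinearMap.ker φ
      let B' : LinearMap.BilinForm K W := B.domRestrict₁₂ W W
      have hB' : B'.IsAlt := fun x => hB x
      have hker : (LinearMap.ker B').map W.subtype = LinearMap.ker B := by
        ext x
        constructor
        · rintro ⟨⟨y, hy⟩, hyk, rfl⟩
          have hy' : B v y = 0 ∧ B w y = 0 := by
            simpa [W, φ, Prod.ext_iff] using hy
          refine LinearMap.ext fun z => ?_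
          -- Projection onto W along the plane spanned by v and w.
          have hz : z - (B v z • w - B w z • v) ∈ W := by
            simp [W, φ, hvw, hwv, hB.self_eq_zero]
          have := LinearMap.congr_fun hyk ⟨_, hz⟩
          have e : B y (z - (B v z • w - B w z • v)) = 0 := this
          have e1 : B y v = 0 := by rw [← hB.neg_eq, hy'.1, neg_zero]
          have e2 : B y w = 0 := by rw [← hB.neg_eq, hy'.2, neg_zero]
          simpa [e1, e2] using e
        · intro hx
          have hx' : B x = 0 := hx
          have e1 : B v x = 0 := by rw [← hB.neg_eq, hx']; simp
          have e2 : B w x = 0 := by rw [← hB.neg_eq, hx']; simp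
          refine ⟨⟨x, by simp [W, φ, e1, e2]⟩, ?_, rfl⟩
          refine LinearMap.ext fun z => ?_
          change B x z = 0
          rw [hx']; rfl
      have := ih (Module.finrank K W) (by change 1 + 1 + Module.finrank K W = _ at hrank; omega)
        B' hB' rfl
      rw [← hker, Submodule.finrank_map_subtype_eq]
      change 1 + 1 + Module.finrank K W = _ at hrank
      rw [← hrank]
      rw [Nat.even_iff] at this ⊢
      omega

theorem LinearMap.finrank_ker_comp_le {K V₁ V₂ V₃ : Type*} [Field K] [AddCommGroup V₁]
    [Module K V₁] [AddCommGroup V₂] [Module K V₂] [AddCommGroup V₃] [Module K V₃]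
    [FiniteDimensional K V₁] [FiniteDimensional K V₂] (g : V₂ →ₗ[K] V₃) (f : V₁ →ₗ[K] V₂) :
    Module.finrank K (LinearMap.ker (g ∘ₗ f)) ≤
      Module.finrank K (LinearMap.ker g) + Module.finrank K (LinearMap.ker f) := by
  let h : LinearMap.ker (g ∘ₗ f) →ₗ[K] LinearMap.ker g :=
    f.restrict fun x hx => by simpa using hx
  have h1 := LinearMap.finrank_range_add_finrank_ker h
  have h2 := Submodule.finrank_le (LinearMap.range h)
  have h3 : Module.finrank K (LinearMap.ker h) ≤ Module.finrank K (LinearMap.ker f) := by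
    rw [← Submodule.finrank_map_subtype_eq]
    refine Submodule.finrank_mono ?_
    rintro _ ⟨x, hx, rfl⟩
    exact congrArg Subtype.val (show h x = 0 from hx)
  omega

/-! ### Kernels of polynomials in an automorphism. -/

section SigmaPolynomial

variable {K F : Type*} [Field K] [Field F] [Algebra K F]

/-- The `K`-linear operator `∑ i ≤ e, a i * σ ^ i`. -/
noncomputable def sigmaPoly (σ : F ≃ₐ[K] F) (e : ℕ) (a : ℕ → F) : F →ₗ[K] F :=
  ∑ i ∈ Finset.range (e + 1), LinearMap.mulLeft K (a i) ∘ₗ (σ ^ i).toLinearMap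

theorem sigmaPoly_apply (σ : F ≃ₐ[K] F) (e : ℕ) (a : ℕ → F) (x : F) :
    sigmaPoly σ e a x = ∑ i ∈ Finset.range (e + 1), a i * (σ ^ i) x := by
  simp [sigmaPoly]

/-- A nonzero `σ`-polynomial of degree at most `e` has a kernel of dimension at most `e` over the
fixed field of `σ`. -/
theorem finrank_ker_sigmaPoly_le [FiniteDimensional K F] (σ : F ≃ₐ[K] F)
    (hσ : ∀ x, σ x = x → x ∈ Set.range (algebraMap K F)) (e : ℕ) :
    ∀ a : ℕ → F, (∃ i ≤ e, a i ≠ 0) →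
      Module.finrank K (LinearMap.ker (sigmaPoly σ e a)) ≤ e := by
  induction e with
  | zero =>
    rintro a ⟨i, hi, ha⟩
    obtain rfl : i = 0 := by omega
    have : LinearMap.ker (sigmaPoly σ 0 a) = ⊥ := by
      refine LinearMap.ker_eq_bot'.2 fun x hx => ?_
      simpa [sigmaPoly_apply, ha] using hx
    rw [this, finrank_bot]
  | succ e ih =>
    intro a ha
    by_cases hbot : LinearMap.ker (sigmaPoly σ (e + 1) a) = ⊥
    · rw [hbot, finrank_bot]; omega
    obtain ⟨x₀, hx₀, hne⟩ := Submodule.exists_mem_ne_zero_of_ne_bot hbot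
    -- Composed with multiplication by a kernel element x₀, the operator becomes ∑ bᵢσⁱ with ∑ bᵢ =
    -- 0. It is therefore divisible by σ - 1 on the right, and Abel summation gives the coefficients
    -- cᵢ of the quotient, of degree at most e.
    let b : ℕ → F := fun i => a i * (σ ^ i) x₀
    have hb : ∑ i ∈ Finset.range (e + 2), b i = 0 := by
      have := LinearMap.mem_ker.1 hx₀
      rwa [sigmaPoly_apply] at this
    let c : ℕ → F := fun i => -∑ j ∈ Finset.range (i + 1), b j
    let D : F →ₗ[K] F := σ.toLinearMap - LinearMap.id
    have hcomp : sigmaPoly σ (e + 1) a ∘ₗ LinearMap.mulLeft K x₀ = sigmaPoly σ e c ∘ₗ D := by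
      ext y
      have key := Finset.sum_range_by_parts (fun i => (σ ^ i) y) b (e + 2)
      simp only [smul_eq_mul, hb, mul_zero, zero_sub,
        show e + 2 - 1 = e + 1 from rfl] at key
      simp only [LinearMap.comp_apply, sigmaPoly_apply, LinearMap.mulLeft_apply, map_mul]
      have e1 : ∀ i, a i * ((σ ^ i) x₀ * (σ ^ i) y) = (σ ^ i) y * b i := fun i => by
        simp only [b]; ring
      simp only [e1]
      rw [key, ← Finset.sum_neg_distrib]
      refine Finset.sum_congr rfl fun i _ => ?_
      simp only [c, D, LinearMap.sub_apply, LinearMap.id_apply, AlgEquiv.toLinearMap_apply,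
        map_sub, pow_succ, AlgEquiv.mul_apply]
      ring
    have hc : ∃ i ≤ e, c i ≠ 0 := by
      by_contra! hall
      obtain ⟨i, hi, hai⟩ := ha
      have hs : ∀ i ≤ e + 1, ∑ j ∈ Finset.range (i + 1), b j = 0 := by
        intro i hi
        rcases Nat.lt_or_ge e i with h | h
        · obtain rfl : i = e + 1 := by omega
          exact hb
        · exact neg_eq_zero.1 (hall i h)
      have hbi : b i = 0 := by
        cases i with
        | zero => simpa using hs 0 hi
        | succ i =>
          have := hs (i + 1) hi
          rw [Finset.sum_range_succ, hs i (by omega), zero_add] at this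
          exact this
      have : (σ ^ i) x₀ ≠ 0 := (map_ne_zero_iff _ (σ ^ i).injective).2 hne
      exact (mul_ne_zero hai this) hbi
    have hD : Module.finrank K (LinearMap.ker D) ≤ 1 := by
      refine (Submodule.finrank_mono (t := K ∙ (1 : F)) fun x hx => ?_).trans
        (finrank_span_singleton (one_ne_zero)).le
      obtain ⟨r, rfl⟩ := hσ x (sub_eq_zero.1 (show σ x - x = 0 from hx))
      exact Submodule.mem_span_singleton.2 ⟨r, by rw [Algebra.smul_def, mul_one]⟩
    have h1 := LinearMap.finrank_ker_comp_le (sigmaPoly σ e c) D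
    rw [← hcomp] at h1
    have h2 := ih c hc
    have h3 : Module.finrank K (LinearMap.ker (sigmaPoly σ (e + 1) a)) ≤
        Module.finrank K
          (LinearMap.ker (sigmaPoly σ (e + 1) a ∘ₗ LinearMap.mulLeft K x₀)) := by
      have hsub : LinearMap.ker (sigmaPoly σ (e + 1) a) ≤
          (LinearMap.ker (sigmaPoly σ (e + 1) a ∘ₗ LinearMap.mulLeft K x₀)).map
            (LinearMap.mulLeft K x₀) := by
        intro x hx
        refine ⟨x₀⁻¹ * x, ?_, ?_⟩
        · simpa [hne] using hx
        · simp [hne]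
      exact (Submodule.finrank_mono hsub).trans (Submodule.finrank_map_le _ _)
    omega

end SigmaPolynomial

/-! ### Additive characters and sums over quadratic functions. -/

section Character

variable {F : Type*} [Field F] [Algebra (ZMod 2) F]

theorem addChi_zero : addChi (0 : F) = 1 := by simp [addChi]

theorem addChi_add (x y : F) : addChi (x + y) = addChi x * addChi y := by
  have key : ∀ a b : ZMod 2, (-1 : ℤ) ^ (a + b).val = (-1) ^ a.val * (-1) ^ b.val := by decide
  simp only [addChi, map_add, key]

theorem addChi_mul_self (x : F) : addChi x * addChi x = 1 := by
  rw [addChi, ← mul_pow]; norm_num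

theorem addChi_eq_one_iff (x : F) : addChi x = 1 ↔ Algebra.trace (ZMod 2) F x = 0 := by
  have key : ∀ a : ZMod 2, (-1 : ℤ) ^ a.val = 1 ↔ a = 0 := by decide
  exact key _

/-- The canonical additive character, bundled. -/
noncomputable def addChiHom (F : Type*) [Field F] [Algebra (ZMod 2) F] : AddChar F ℤ where
  toFun := addChi
  map_zero_eq_one' := addChi_zero
  map_add_eq_mul' := addChi_add

theorem addChi_algEquiv (σ : F ≃ₐ[ZMod 2] F) (x : F) : addChi (σ x) = addChi x := by
  rw [addChi, Algebra.trace_eq_of_algEquiv σ, addChi]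

variable [Fintype F]

theorem forall_addChi_mul_eq_one_iff (a : F) : (∀ x, addChi (a * x) = 1) ↔ a = 0 := by
  constructor
  · intro h
    exact (traceForm_nondegenerate (ZMod 2) F).1 a fun x => (addChi_eq_one_iff _).1 (h x)
  · rintro rfl x
    rw [zero_mul, addChi_zero]

theorem sum_addChi_mul [DecidableEq F] (a : F) :
    ∑ x : F, addChi (a * x) = if a = 0 then (Fintype.card F : ℤ) else 0 := by
  have h := AddChar.sum_eq_ite ((addChiHom F).compAddMonoidHom (AddMonoidHom.mulLeft a))
  have h0 : (addChiHom F).compAddMonoidHom (AddMonoidHom.mulLeft a) = 0 ↔ a = 0 := by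
    rw [← forall_addChi_mul_eq_one_iff, DFunLike.ext_iff]
    rfl
  simp only [h0] at h
  exact h

variable (f : F → F) (L : F →+ F)

/-- The exponential sum of `f x + γ x`. -/
noncomputable def linTwist (γ : F) : ℤ := ∑ x : F, addChi (f x + γ * x)

theorem sum_linTwist (h0 : addChi (f 0) = 1) : ∑ γ, linTwist f γ = Fintype.card F := by
  classical
  unfold linTwist
  rw [Finset.sum_comm]
  simp only [addChi_add, ← Finset.mul_sum]
  have h (y : F) : ∑ γ : F, addChi (γ * y) = if y = 0 then (Fintype.card F : ℤ) else 0 := by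
    simp only [mul_comm _ y, sum_addChi_mul]
  simp [h, h0]

variable (hf : ∀ x z, addChi (f (x + z)) = addChi (f x) * addChi (f z) * addChi (L z * x))

include hf

/-- Shifting the second variable to x + z makes the terms in x alone square to 1. By `hf` only the
character of L(z)x still depends on x, and orthogonality restricts z to the kernel of L. -/
theorem linTwist_sq [DecidableEq F] (γ : F) : linTwist f γ ^ 2 =
    Fintype.card F * ∑ z with L z = 0, addChi (f z + γ * z) := by
  have h1 : linTwist f γ ^ 2 = ∑ z : F, addChi (f z + γ * z) * ∑ x, addChi (L z * x) := by
    rw [sq]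
    conv_lhs => rw [linTwist, Finset.sum_mul]
    have : ∀ x, addChi (f x + γ * x) * linTwist f γ =
        ∑ z, addChi (f z + γ * z) * addChi (L z * x) := by
      intro x
      rw [linTwist, ← Equiv.sum_comp (Equiv.addLeft x), Finset.mul_sum]
      refine Finset.sum_congr rfl fun z _ => ?_
      have e1 := addChi_mul_self (f x)
      have e2 := addChi_mul_self (γ * x)
      simp only [Equiv.coe_addLeft, mul_add, addChi_add, hf]
      linear_combination (addChi (γ * x) * addChi (γ * x) * addChi (f z) * addChi (L z * x) *
        addChi (γ * z)) * e1 + (addChi (f z) * addChi (L z * x) * addChi (γ * z)) * e2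
    change ∑ x, addChi (f x + γ * x) * linTwist f γ = _
    simp only [this]
    rw [Finset.sum_comm]
    simp only [Finset.mul_sum]
  rw [h1]
  simp only [sum_addChi_mul, mul_ite, mul_zero]
  rw [← Finset.sum_filter, Finset.mul_sum]
  exact Finset.sum_congr rfl fun _ _ => mul_comm _ _

/-- On the kernel of L the polarization is trivial, so the summand in `linTwist_sq` is a character
there, and it sums to 0 or to the order of the kernel. -/
theorem linTwist_sq_eq_zero_or (γ : F) :
    linTwist f γ ^ 2 = 0 ∨ linTwist f γ ^ 2 = Fintype.card F * Nat.card L.ker := by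
  classical
  let ψ : AddChar L.ker ℤ :=
    { toFun := fun z => addChi (f z + γ * z)
      map_zero_eq_one' := by
        have h := hf 0 0
        simp only [add_zero, map_zero, zero_mul, addChi_zero, mul_one, addChi_mul_self] at h
        simp [h]
      map_add_eq_mul' := by
        rintro ⟨x, hx⟩ ⟨z, hz⟩
        have hz' : L z = 0 := hz
        simp only [AddSubgroup.coe_add, mul_add, addChi_add, hf, hz', zero_mul, addChi_zero]
        ring }
  rw [linTwist_sq f L hf]
  have h : ∑ z : L.ker, addChi (f z + γ * z) = if ψ = 0 then (Fintype.card L.ker : ℤ) else 0 :=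
    AddChar.sum_eq_ite ψ
  rw [Finset.sum_subtype (p := fun z => z ∈ L.ker) _ (by simp), h, Nat.card_eq_fintype_card]
  split_ifs
  · exact Or.inr rfl
  · left; simp

theorem sum_linTwist_sq (h0 : addChi (f 0) = 1) :
    ∑ γ, linTwist f γ ^ 2 = (Fintype.card F : ℤ) ^ 2 := by
  classical
  simp only [linTwist_sq f L hf, ← Finset.mul_sum]
  rw [Finset.sum_comm]
  simp only [addChi_add, ← Finset.mul_sum]
  have h (y : F) : ∑ γ : F, addChi (γ * y) = if y = 0 then (Fintype.card F : ℤ) else 0 := by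
    simp only [mul_comm _ y, sum_addChi_mul]
  simp [h, h0, sq]

/-- The value distribution of `linTwist f` when `|F| * |ker L|` is a square. -/
theorem card_linTwist_eq (h0 : addChi (f 0) = 1) (M : ℤ) (hM : 0 < M)
    (hML : (Fintype.card F : ℤ) * Nat.card L.ker = M ^ 2) :
    (∀ γ, linTwist f γ = M ∨ linTwist f γ = -M ∨ linTwist f γ = 0) ∧
    (({γ | linTwist f γ = M} : Set F).ncard : ℚ) =
      ((Fintype.card F / M) ^ 2 + Fintype.card F / M) / 2 ∧
    (({γ | linTwist f γ = -M} : Set F).ncard : ℚ) =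
      ((Fintype.card F / M) ^ 2 - Fintype.card F / M) / 2 ∧
    (({γ | linTwist f γ = 0} : Set F).ncard : ℚ) =
      Fintype.card F - (Fintype.card F / M : ℚ) ^ 2 := by
  classical
  have hval : ∀ γ, linTwist f γ = M ∨ linTwist f γ = -M ∨ linTwist f γ = 0 := by
    intro γ
    rcases linTwist_sq_eq_zero_or f L hf γ with h | h
    · exact Or.inr (Or.inr (pow_eq_zero_iff two_ne_zero |>.1 h))
    · rw [hML] at h
      rcases sq_eq_sq_iff_eq_or_eq_neg.1 h with h | h
      · exact Or.inl h
      · exact Or.inr (Or.inl h)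
  refine ⟨hval, ?_⟩
  have hs := sum_linTwist f h0
  have hs2 := sum_linTwist_sq f L hf h0
  -- Summed over γ, these three identities turn the first, second and zeroth moments into a linear
  -- system for the three counts.
  have e1 : ∀ γ, linTwist f γ = M * (if linTwist f γ = M then 1 else 0) -
      M * (if linTwist f γ = -M then 1 else 0) := by
    intro γ
    rcases hval γ with h | h | h <;> rw [h]
    · rw [if_pos rfl, if_neg (by omega)]; ring
    · rw [if_neg (by omega), if_pos rfl]; ring
    · rw [if_neg (by omega), if_neg (by omega)]; ring
  have e2 : ∀ γ, linTwist f γ ^ 2 = M ^ 2 * (if linTwist f γ = M then 1 else 0) +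
      M ^ 2 * (if linTwist f γ = -M then 1 else 0) := by
    intro γ
    rcases hval γ with h | h | h <;> rw [h]
    · rw [if_pos rfl, if_neg (by omega)]; ring
    · rw [if_neg (by omega), if_pos rfl]; ring
    · rw [if_neg (by omega), if_neg (by omega)]; ring
  have e3 : ∀ γ : F, (1 : ℤ) = (if linTwist f γ = M then 1 else 0) +
      (if linTwist f γ = -M then 1 else 0) + (if linTwist f γ = 0 then 1 else 0) := by
    intro γ
    rcases hval γ with h | h | h <;> rw [h]
    · rw [if_pos rfl, if_neg (by omega), if_neg (by omega)]; ring
    · rw [if_neg (by omega), if_pos rfl, if_neg (by omega)]; ring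
    · rw [if_neg (by omega), if_neg (by omega), if_pos rfl]; ring
  have hs3 : ∑ γ : F, (1 : ℤ) = Fintype.card F := by simp
  rw [Finset.sum_congr rfl fun γ _ => e3 γ, Finset.sum_add_distrib, Finset.sum_add_distrib,
    Finset.sum_boole, Finset.sum_boole, Finset.sum_boole] at hs3
  rw [Finset.sum_congr rfl fun γ _ => e1 γ, Finset.sum_sub_distrib, ← Finset.mul_sum,
    ← Finset.mul_sum, Finset.sum_boole, Finset.sum_boole] at hs
  rw [Finset.sum_congr rfl fun γ _ => e2 γ, Finset.sum_add_distrib, ← Finset.mul_sum,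
    ← Finset.mul_sum, Finset.sum_boole, Finset.sum_boole] at hs2
  simp only [Set.ncard_eq_toFinset_card', Set.toFinset_ofPred]
  have hM' : (M : ℚ) ≠ 0 := by exact_mod_cast hM.ne'
  replace hs := congrArg (Int.cast : ℤ → ℚ) hs
  replace hs2 := congrArg (Int.cast : ℤ → ℚ) hs2
  replace hs3 := congrArg (Int.cast : ℤ → ℚ) hs3
  push_cast at hs hs2 hs3
  refine ⟨?_, ?_, ?_⟩
  · field_simp
    linear_combination hs2 + M * hs
  · field_simp
    linear_combination hs2 - M * hs
  · field_simp
    linear_combination (M : ℚ) ^ 2 * hs3 - hs2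

end Character

/-! ### The polar operator: its nullity and the distribution of nullities. -/

section Polar

variable {K F : Type*} [Field K] [Field F] [Algebra K F] (σ : F ≃ₐ[K] F)

/-- The operator `x ↦ α σ²x + σ⁻²(α x) + β σx + σ⁻¹(β x)`, the polarization of
`x ↦ α x σ²x + β x σx` with respect to the trace form. -/
noncomputable def polarOp (α β : F) : F →ₗ[K] F :=
  LinearMap.mulLeft K α ∘ₗ σ.toLinearMap ∘ₗ σ.toLinearMap +
    σ.symm.toLinearMap ∘ₗ σ.symm.toLinearMap ∘ₗ LinearMap.mulLeft K α +
    LinearMap.mulLeft K β ∘ₗ σ.toLinearMap + σ.symm.toLinearMap ∘ₗ LinearMap.mulLeft K β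

theorem polarOp_apply (α β x : F) : polarOp σ α β x =
    α * σ (σ x) + σ.symm (σ.symm (α * x)) + β * σ x + σ.symm (β * x) := rfl

theorem polarOp_zero : polarOp σ 0 0 = 0 := by
  ext x; simp [polarOp_apply]

/-- This is hypothesis `hf` of the character-sum lemmas. Invariance of the trace under σ⁻¹ frees x
from σ in the cross terms. -/
theorem addChi_quadratic_add [Algebra (ZMod 2) F] [Algebra (ZMod 2) K]
    [IsScalarTower (ZMod 2) K F] (α β x z : F) :
    addChi (α * ((x + z) * σ (σ (x + z))) + β * ((x + z) * σ (x + z))) =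
      addChi (α * (x * σ (σ x)) + β * (x * σ x)) * addChi (α * (z * σ (σ z)) + β * (z * σ z)) *
        addChi (polarOp σ α β z * x) := by
  have hτ (y : F) : addChi (σ.symm y) = addChi y :=
    addChi_algEquiv (σ.symm.restrictScalars (ZMod 2)) y
  have h1 : addChi (σ.symm (σ.symm (α * z)) * x) = addChi (α * z * σ (σ x)) := by
    rw [← hτ (α * z * σ (σ x)), ← hτ (σ.symm _)]; simp
  have h2 : addChi (σ.symm (β * z) * x) = addChi (β * z * σ x) := by
    rw [← hτ (β * z * σ x)]; simp
  have h3 : addChi (polarOp σ α β z * x) =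
      addChi (α * σ (σ z) * x + α * z * σ (σ x) + β * σ z * x + β * z * σ x) := by
    simp only [polarOp_apply, add_mul, addChi_add, h1, h2]
  rw [h3, ← addChi_add, ← addChi_add]
  congr 1
  simp only [map_add]
  ring

/-- Applying σ² clears the inverse powers: the result is α + σ(β)σ + σ²(β)σ³ + σ²(α)σ⁴. -/
theorem finrank_ker_polarOp_le [FiniteDimensional K F]
    (hσ : ∀ x, σ x = x → x ∈ Set.range (algebraMap K F)) {α β : F} (h : (α, β) ≠ 0) :
    Module.finrank K (LinearMap.ker (polarOp σ α β)) ≤ 4 := by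
  let a : ℕ → F := fun i => match i with
    | 0 => α
    | 1 => σ β
    | 3 => σ (σ β)
    | 4 => σ (σ α)
    | _ => 0
  have hcomp : σ.toLinearMap ∘ₗ σ.toLinearMap ∘ₗ polarOp σ α β = sigmaPoly σ 4 a := by
    ext x
    simp only [LinearMap.comp_apply, polarOp_apply, sigmaPoly_apply, AlgEquiv.toLinearMap_apply,
      Finset.sum_range_succ, Finset.sum_range_zero, a, map_add, map_mul, AlgEquiv.apply_symm_apply,
      pow_succ, pow_zero, AlgEquiv.mul_apply, AlgEquiv.one_apply]
    ring
  have ha : ∃ i ≤ 4, a i ≠ 0 := by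
    by_contra! hall
    refine h (Prod.ext (hall 0 (by norm_num)) ?_)
    simpa [a] using hall 1 (by norm_num)
  refine (Submodule.finrank_mono fun x hx => ?_).trans (finrank_ker_sigmaPoly_le σ hσ 4 a ha)
  rw [LinearMap.mem_ker] at hx
  rw [← hcomp]
  simp [hx]

/-- The two terms in α have equal trace, as do the two in β, so they cancel in characteristic 2.
This makes the trace form of the polar operator alternating. -/
theorem trace_polarOp_mul_self [CharP K 2] (α β x : F) :
    Algebra.trace K F (polarOp σ α β x * x) = 0 := by
  have hτ (y : F) : Algebra.trace K F (σ.symm y) = Algebra.trace K F y :=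
    Algebra.trace_eq_of_algEquiv σ.symm y
  have h1 : Algebra.trace K F (σ.symm (σ.symm (α * x)) * x) =
      Algebra.trace K F (α * σ (σ x) * x) := by
    rw [← hτ (α * σ (σ x) * x), ← hτ (σ.symm _)]; simp; ring_nf
  have h2 : Algebra.trace K F (σ.symm (β * x) * x) = Algebra.trace K F (β * σ x * x) := by
    rw [← hτ (β * σ x * x)]; simp; ring_nf
  rw [polarOp_apply, add_mul, add_mul, add_mul, map_add, map_add, map_add, h1, h2,
    CharTwo.add_self_eq_zero, zero_add, CharTwo.add_self_eq_zero]

theorem finrank_ker_polarOp [FiniteDimensional K F] [CharP K 2] [Algebra.IsSeparable K F]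
    (hσ : ∀ x, σ x = x → x ∈ Set.range (algebraMap K F)) (hodd : Odd (Module.finrank K F))
    {α β : F} (h : (α, β) ≠ 0) :
    Module.finrank K (LinearMap.ker (polarOp σ α β)) = 1 ∨
      Module.finrank K (LinearMap.ker (polarOp σ α β)) = 3 := by
  have h4 := finrank_ker_polarOp_le σ hσ h
  let B : LinearMap.BilinForm K F := Algebra.traceForm K F ∘ₗ polarOp σ α β
  have hB : B.IsAlt := fun x => trace_polarOp_mul_self σ α β x
  have hker : LinearMap.ker B = LinearMap.ker (polarOp σ α β) :=
    LinearMap.ker_comp_of_ker_eq_bot _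
      (LinearMap.ker_eq_bot'.2 fun x hx =>
        (traceForm_nondegenerate K F).1 x fun y => LinearMap.congr_fun hx y)
  have hev := LinearMap.BilinForm.IsAlt.even_finrank_add_finrank_ker _ B hB rfl
  rw [hker, Nat.even_add] at hev
  have : Odd (Module.finrank K (LinearMap.ker (polarOp σ α β))) := by
    rw [← Nat.not_even_iff_odd] at hodd ⊢
    tauto
  rw [Nat.odd_iff] at this
  omega

/-- With a = α x σ²x and b = β x σx, one has L(x)x = c + σ⁻¹c for c = b + a + σ⁻¹a. This vanishes
exactly when c ∈ K, so the solutions are parametrized freely by a ∈ F and c ∈ K, through the map Ψ.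
-/
theorem card_polarOp_apply_eq_zero [CharP F 2]
    (hσ : ∀ x, σ x = x → x ∈ Set.range (algebraMap K F)) {x : F} (hx : x ≠ 0) :
    Nat.card {p : F × F // polarOp σ p.1 p.2 x = 0} = Nat.card F * Nat.card K := by
  have hσx : σ x ≠ 0 := by simpa using hx
  have hσσx : σ (σ x) ≠ 0 := by simpa using hx
  let Ψ : F × K → F × F := fun p =>
    (p.1 / (x * σ (σ x)), (algebraMap K F p.2 + p.1 + σ.symm p.1) / (x * σ x))
  have hinj : Function.Injective Ψ := by
    rintro ⟨a, c⟩ ⟨a', c'⟩ h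
    simp only [Ψ, Prod.mk.injEq] at h
    obtain rfl : a = a' := (div_left_inj' (mul_ne_zero hx hσσx)).1 h.1
    have h2 := (div_left_inj' (mul_ne_zero hx hσx)).1 h.2
    simpa using h2
  have key (a b : F) : polarOp σ (a / (x * σ (σ x))) (b / (x * σ x)) x * x =
      (b + a + σ.symm a) + σ.symm (b + a + σ.symm a) := by
    have e1 : σ.symm (σ.symm (a / (x * σ (σ x)) * x)) * x = σ.symm (σ.symm a) := by
      have : a / (x * σ (σ x)) * x = a / σ (σ x) := by field_simp
      rw [this]
      simp only [map_div₀, AlgEquiv.symm_apply_apply]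
      field_simp
    have e2 : σ.symm (b / (x * σ x) * x) * x = σ.symm b := by
      have : b / (x * σ x) * x = b / σ x := by field_simp
      rw [this]
      simp only [map_div₀, AlgEquiv.symm_apply_apply]
      field_simp
    have e3 : a / (x * σ (σ x)) * σ (σ x) * x = a := by field_simp
    have e4 : b / (x * σ x) * σ x * x = b := by field_simp
    rw [polarOp_apply, add_mul, add_mul, add_mul, e1, e2, e3, e4]
    simp only [map_add]
    linear_combination (-1 : F) * CharTwo.add_self_eq_zero (σ.symm a)
  have hrange : {p : F × F | polarOp σ p.1 p.2 x = 0} = Set.range Ψ := by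
    ext ⟨α, β⟩
    constructor
    · intro h
      have h0 := key (α * (x * σ (σ x))) (β * (x * σ x))
      rw [mul_div_cancel_right₀ _ (mul_ne_zero hx hσσx), mul_div_cancel_right₀ _
        (mul_ne_zero hx hσx), show polarOp σ α β x = 0 from h, zero_mul] at h0
      have h1 := CharTwo.add_eq_zero.1 h0.symm
      obtain ⟨c, hc⟩ := hσ _ ((σ.eq_symm_apply.1 h1))
      refine ⟨(α * (x * σ (σ x)), c), ?_⟩
      simp only [Ψ, hc, Prod.mk.injEq]
      refine ⟨mul_div_cancel_right₀ _ (mul_ne_zero hx hσσx), ?_⟩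
      rw [div_eq_iff (mul_ne_zero hx hσx)]
      linear_combination CharTwo.add_self_eq_zero (α * (x * σ (σ x))) +
        CharTwo.add_self_eq_zero (σ.symm (α * (x * σ (σ x))))
    · rintro ⟨⟨a, c⟩, h⟩
      simp only [Ψ, Prod.mk.injEq] at h
      have h0 := key a (algebraMap K F c + a + σ.symm a)
      rw [h.1, h.2] at h0
      have h1 : algebraMap K F c + a + σ.symm a + a + σ.symm a = algebraMap K F c := by
        linear_combination CharTwo.add_self_eq_zero a + CharTwo.add_self_eq_zero (σ.symm a)
      rw [h1, AlgEquiv.commutes, CharTwo.add_self_eq_zero] at h0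
      exact (mul_eq_zero.1 h0).resolve_right hx
  have := Nat.card_range_of_injective hinj
  rw [← hrange, Nat.card_prod] at this
  exact this

theorem sum_card_ker_polarOp [Fintype F] [CharP F 2]
    (hσ : ∀ x, σ x = x → x ∈ Set.range (algebraMap K F)) :
    ∑ p : F × F, Nat.card (LinearMap.ker (polarOp σ p.1 p.2)) =
      Nat.card F ^ 2 + (Nat.card F - 1) * (Nat.card F * Nat.card K) := by
  classical
  have h1 : ∀ p : F × F, Nat.card (LinearMap.ker (polarOp σ p.1 p.2)) =
      ∑ x : F, if polarOp σ p.1 p.2 x = 0 then 1 else 0 := by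
    intro p
    rw [Finset.sum_boole, Nat.cast_id, ← Fintype.card_subtype, ← Nat.card_eq_fintype_card]
    rfl
  simp only [h1]
  rw [Finset.sum_comm, ← Finset.add_sum_erase _ _ (Finset.mem_univ 0)]
  congr 1
  · simp [sq]
  · have h2 : ∀ x ∈ Finset.univ.erase (0 : F),
        (∑ p : F × F, if polarOp σ p.1 p.2 x = 0 then 1 else 0) = Nat.card F * Nat.card K := by
      intro x hx
      rw [Finset.sum_boole, Nat.cast_id, ← Fintype.card_subtype, ← Nat.card_eq_fintype_card]
      exact card_polarOp_apply_eq_zero σ hσ (Finset.ne_of_mem_erase hx)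
    rw [Finset.sum_congr rfl h2, Finset.sum_const, Finset.card_erase_of_mem (Finset.mem_univ _),
      smul_eq_mul, Finset.card_univ, Nat.card_eq_fintype_card]

/-- The numbers of pairs `(α, β) ≠ 0` whose polar operator has nullity `1` and `3`. -/
theorem ncard_finrank_ker_polarOp [Fintype F] [CharP F 2] [CharP K 2]
    (hσ : ∀ x, σ x = x → x ∈ Set.range (algebraMap K F)) (hodd : Odd (Module.finrank K F)) :
    (({p | p ≠ 0 ∧ Module.finrank K (LinearMap.ker (polarOp σ p.1 p.2)) = 3} :
        Set (F × F)).ncard : ℚ) =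
      (Nat.card F - 1) * (Nat.card F / Nat.card K - 1) / ((Nat.card K : ℚ) ^ 2 - 1) ∧
    (({p | p ≠ 0 ∧ Module.finrank K (LinearMap.ker (polarOp σ p.1 p.2)) = 1} :
        Set (F × F)).ncard : ℚ) = (Nat.card F : ℚ) ^ 2 - 1 -
      (Nat.card F - 1) * (Nat.card F / Nat.card K - 1) / ((Nat.card K : ℚ) ^ 2 - 1) := by
  classical
  have : Finite K := Finite.of_injective _ (algebraMap K F).injective
  set r : F × F → ℕ := fun p => Module.finrank K (LinearMap.ker (polarOp σ p.1 p.2)) with hr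
  have hcard (p : F × F) : Nat.card (LinearMap.ker (polarOp σ p.1 p.2)) = Nat.card K ^ r p :=
    Module.natCard_eq_pow_finrank
  have hr13 : ∀ p ∈ Finset.univ.erase (0 : F × F), r p = 1 ∨ r p = 3 := fun p hp =>
    finrank_ker_polarOp σ hσ hodd (Finset.ne_of_mem_erase hp)
  have hS := sum_card_ker_polarOp σ hσ
  rw [← Finset.add_sum_erase _ _ (Finset.mem_univ 0)] at hS
  have e0 : Nat.card (LinearMap.ker (polarOp σ (0 : F × F).1 (0 : F × F).2)) = Nat.card F := by
    rw [Prod.fst_zero, Prod.snd_zero, polarOp_zero, LinearMap.ker_zero]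
    exact Nat.card_congr Submodule.topEquiv.toEquiv
  have e1 : ∀ p ∈ Finset.univ.erase (0 : F × F),
      Nat.card (LinearMap.ker (polarOp σ p.1 p.2)) =
        Nat.card K * (if r p = 1 then 1 else 0) + Nat.card K ^ 3 * (if r p = 3 then 1 else 0) := by
    intro p hp
    rw [hcard]
    rcases hr13 p hp with h | h <;> simp [h]
  have e2 : ∀ p ∈ Finset.univ.erase (0 : F × F),
      1 = (if r p = 1 then 1 else 0) + (if r p = 3 then 1 else 0) := by
    intro p hp
    rcases hr13 p hp with h | h <;> simp [h]
  have hT : ∑ p ∈ Finset.univ.erase (0 : F × F), 1 = Nat.card F * Nat.card F - 1 := by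
    rw [← Finset.card_eq_sum_ones, Finset.card_erase_of_mem (Finset.mem_univ _), Finset.card_univ,
      ← Nat.card_eq_fintype_card, Nat.card_prod]
  rw [e0, Finset.sum_congr rfl e1, Finset.sum_add_distrib, ← Finset.mul_sum, ← Finset.mul_sum,
    Finset.sum_boole, Finset.sum_boole, Nat.cast_id, Nat.cast_id] at hS
  rw [Finset.sum_congr rfl e2, Finset.sum_add_distrib, Finset.sum_boole, Finset.sum_boole,
    Nat.cast_id, Nat.cast_id] at hT
  have hset (i : ℕ) : ({p | p ≠ 0 ∧ r p = i} : Set (F × F)).ncard =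
      ((Finset.univ.erase (0 : F × F)).filter fun p => r p = i).card := by
    rw [← Set.ncard_coe_finset]
    congr 1
    ext p
    simp
  rw [hset, hset]
  generalize ((Finset.univ.erase (0 : F × F)).filter fun p => r p = 1).card = N1 at *
  generalize ((Finset.univ.erase (0 : F × F)).filter fun p => r p = 3).card = N3 at *
  have hq : 1 ≤ Nat.card F := Nat.card_pos
  have hK : 1 < Nat.card K := Finite.one_lt_card
  replace hS := congrArg (Nat.cast : ℕ → ℚ) hS
  replace hT := congrArg (Nat.cast : ℕ → ℚ) hT
  rw [Nat.cast_sub (Nat.mul_pos hq hq)] at hT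
  push_cast [Nat.cast_sub hq] at hS hT
  have hK' : (1 : ℚ) < Nat.card K := by exact_mod_cast hK
  generalize (Nat.card F : ℚ) = q at *
  generalize (Nat.card K : ℚ) = y at *
  have hy0 : y ≠ 0 := by positivity
  have hy1 : y ^ 2 - 1 ≠ 0 := by nlinarith
  -- Here `hS` says q + yN₁ + y³N₃ = q² + (q - 1)qy, the leading q coming from the zero pair, and
  -- `hT` says N₁ + N₃ = q² - 1. Eliminate N₁.
  have h3 : (N3 : ℚ) = (q - 1) * (q / y - 1) / (y ^ 2 - 1) := by
    field_simp
    linear_combination hS - y * hT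
  refine ⟨h3, ?_⟩
  rw [← h3]
  linear_combination hT

end Polar

/-! ### The field fixed by x ↦ x^(2^k), and sums grouped by nullity. -/

section FixedField

variable {F : Type*} [Field F] [Fintype F] [Algebra (ZMod 2) F]

/-- The fixed field of `x ↦ x ^ 2 ^ k`. -/
noncomputable abbrev frobFixed (F : Type*) [Field F] [Fintype F] [Algebra (ZMod 2) F] (k : ℕ) :
    IntermediateField (ZMod 2) F :=
  IntermediateField.fixedField
    (Subgroup.zpowers (FiniteField.frobeniusAlgEquivOfAlgebraic (ZMod 2) F ^ k))

theorem frobenius_pow_apply (k : ℕ) (x : F) :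
    (FiniteField.frobeniusAlgEquivOfAlgebraic (ZMod 2) F ^ k) x = x ^ 2 ^ k := by
  rw [AlgEquiv.coe_pow, FiniteField.coe_frobeniusAlgEquivOfAlgebraic_iterate, ZMod.card]

theorem mem_frobFixed {k : ℕ} {x : F} : x ∈ frobFixed F k ↔ x ^ 2 ^ k = x := by
  rw [← frobenius_pow_apply, IntermediateField.mem_fixedField_iff]
  constructor
  · intro h
    exact h _ (Subgroup.mem_zpowers _)
  · intro h g hg
    have : Subgroup.zpowers (FiniteField.frobeniusAlgEquivOfAlgebraic (ZMod 2) F ^ k) ≤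
        MulAction.stabilizer _ x := by
      rw [Subgroup.zpowers_le]
      exact h
    exact this hg

/-- The automorphism `x ↦ x ^ 2 ^ k` over its fixed field. -/
noncomputable def frobOver (F : Type*) [Field F] [Fintype F] [Algebra (ZMod 2) F] (k : ℕ) :
    F ≃ₐ[frobFixed F k] F :=
  AlgEquiv.ofRingEquiv
    (f := (FiniteField.frobeniusAlgEquivOfAlgebraic (ZMod 2) F ^ k).toRingEquiv)
    fun x => (frobenius_pow_apply k _).trans (mem_frobFixed.1 x.2)

theorem frobOver_apply (k : ℕ) (x : F) : frobOver F k x = x ^ 2 ^ k :=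
  frobenius_pow_apply k x

theorem finrank_frobFixed {n : ℕ} (hF : Fintype.card F = 2 ^ n) (k : ℕ) :
    Module.finrank (frobFixed F k) F = n / n.gcd k := by
  have hn : Module.finrank (ZMod 2) F = n := by
    have := Module.card_eq_pow_finrank (K := ZMod 2) (V := F)
    rw [hF, ZMod.card] at this
    exact (Nat.pow_right_injective le_rfl this).symm
  rw [IntermediateField.finrank_fixedField_eq_card, Nat.card_zpowers, orderOf_pow,
    FiniteField.orderOf_frobeniusAlgEquivOfAlgebraic, hn]

theorem card_frobFixed {n : ℕ} (hn : n ≠ 0) (hF : Fintype.card F = 2 ^ n) (k : ℕ) :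
    Nat.card (frobFixed F k) = 2 ^ n.gcd k := by
  have h := Module.natCard_eq_pow_finrank (K := frobFixed F k) (V := F)
  have h2 := Module.natCard_eq_pow_finrank (K := ZMod 2) (V := frobFixed F k)
  rw [Nat.card_zmod] at h2
  rw [finrank_frobFixed hF, h2, Nat.card_eq_fintype_card, hF, ← pow_mul] at h
  have h3 := Nat.pow_right_injective le_rfl h
  rw [h2]
  congr 1
  have hd := Nat.div_mul_cancel (Nat.gcd_dvd_left n k)
  have hpos : 0 < n / n.gcd k := Nat.div_pos (Nat.le_of_dvd (by omega) (Nat.gcd_dvd_left n k))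
    (Nat.gcd_pos_of_pos_left _ (by omega))
  rw [mul_comm] at hd
  exact Nat.eq_of_mul_eq_mul_right hpos (h3.symm.trans hd.symm)

theorem expSum_eq_linTwist (k : ℕ) (α β γ : F) : expSum k α β γ =
    linTwist (fun x => α * (x * frobOver F k (frobOver F k x)) + β * (x * frobOver F k x)) γ := by
  refine Finset.sum_congr rfl fun x _ => ?_
  simp only [frobOver_apply]
  rw [← pow_mul, ← pow_add, ← two_mul, pow_succ' x, pow_succ' x]

theorem expSum_zero_zero [DecidableEq F] (k : ℕ) (γ : F) :
    expSum k 0 0 γ = if γ = 0 then (Fintype.card F : ℤ) else 0 := by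
  rw [← sum_addChi_mul]
  refine Finset.sum_congr rfl fun x _ => ?_
  simp

theorem valueMult_eq_sum (k : ℕ) (v : ℤ) : valueMult F k v =
    ∑ p : F × F, ({γ | expSum k p.1 p.2 γ = v} : Set F).ncard := by
  classical
  have e : ({t : F × F × F | expSum k t.1 t.2.1 t.2.2 = v} : Set (F × F × F)).ncard =
      ({t : (F × F) × F | expSum k t.1.1 t.1.2 t.2 = v} : Set ((F × F) × F)).ncard := by
    refine Set.ncard_congr' ((Equiv.prodAssoc F F F).symm.subtypeEquiv fun t => ?_)
    rfl
  rw [valueMult, e]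
  simp only [Set.ncard_eq_toFinset_card', Set.toFinset_ofPred, Finset.card_filter]
  rw [Fintype.sum_prod_type]

/-- Summation of a count over the classes of pairs `(α, β)` by the nullity of the polar form. -/
theorem valueMult_eq_of_classes (k : ℕ) (v : ℤ) (w₀ w₁ w₃ : ℚ)
    (hr : ∀ p : F × F, p ≠ 0 → Module.finrank (frobFixed F k)
        (LinearMap.ker (polarOp (frobOver F k) p.1 p.2)) = 1 ∨ Module.finrank (frobFixed F k)
        (LinearMap.ker (polarOp (frobOver F k) p.1 p.2)) = 3)
    (h₀ : (({γ | expSum k 0 0 γ = v} : Set F).ncard : ℚ) = w₀)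
    (h₁ : ∀ p : F × F, p ≠ 0 → Module.finrank (frobFixed F k)
        (LinearMap.ker (polarOp (frobOver F k) p.1 p.2)) = 1 →
        (({γ | expSum k p.1 p.2 γ = v} : Set F).ncard : ℚ) = w₁)
    (h₃ : ∀ p : F × F, p ≠ 0 → Module.finrank (frobFixed F k)
        (LinearMap.ker (polarOp (frobOver F k) p.1 p.2)) = 3 →
        (({γ | expSum k p.1 p.2 γ = v} : Set F).ncard : ℚ) = w₃) :
    (valueMult F k v : ℚ) = w₀ +
      (({p | p ≠ 0 ∧ Module.finrank (frobFixed F k)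
        (LinearMap.ker (polarOp (frobOver F k) p.1 p.2)) = 1} : Set (F × F)).ncard : ℚ) * w₁ +
      (({p | p ≠ 0 ∧ Module.finrank (frobFixed F k)
        (LinearMap.ker (polarOp (frobOver F k) p.1 p.2)) = 3} : Set (F × F)).ncard : ℚ) * w₃ := by
  classical
  rw [valueMult_eq_sum, Nat.cast_sum, ← Finset.add_sum_erase _ _ (Finset.mem_univ (0 : F × F))]
  simp only [Prod.fst_zero, Prod.snd_zero]
  rw [h₀, add_assoc]
  congr 1
  set r : F × F → ℕ := fun p => Module.finrank (frobFixed F k)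
    (LinearMap.ker (polarOp (frobOver F k) p.1 p.2))
  have hset (i : ℕ) : ({p | p ≠ 0 ∧ r p = i} : Set (F × F)).ncard =
      ((Finset.univ.erase (0 : F × F)).filter fun p => r p = i).card := by
    rw [← Set.ncard_coe_finset]
    congr 1
    ext p
    simp
  have e : ∀ p ∈ Finset.univ.erase (0 : F × F),
      (({γ | expSum k p.1 p.2 γ = v} : Set F).ncard : ℚ) =
        (if r p = 1 then 1 else 0) * w₁ + (if r p = 3 then 1 else 0) * w₃ := by
    intro p hp
    have hp := Finset.ne_of_mem_erase hp
    rcases hr p hp with h | h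
    · rw [h₁ p hp h]; simp [r, h]
    · rw [h₃ p hp h]; simp [r, h]
  rw [Finset.sum_congr rfl e, Finset.sum_add_distrib, ← Finset.sum_mul, ← Finset.sum_mul,
    Finset.sum_boole, Finset.sum_boole, hset, hset]

/-- At nullity r over K the kernel has order 2^(dr), with d = gcd(n, k), so `he` says that q·|ker|
is the square of 2^e. -/
theorem card_expSum_eq {n : ℕ} (hn : n ≠ 0) (hF : Fintype.card F = 2 ^ n) (k r e : ℕ) {p : F × F}
    (he : n + n.gcd k * r = 2 * e)
    (hr : Module.finrank (frobFixed F k)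
        (LinearMap.ker (polarOp (frobOver F k) p.1 p.2)) = r) :
    (∀ γ, expSum k p.1 p.2 γ = 2 ^ e ∨ expSum k p.1 p.2 γ = -2 ^ e ∨ expSum k p.1 p.2 γ = 0) ∧
    (({γ | expSum k p.1 p.2 γ = 2 ^ e} : Set F).ncard : ℚ) =
      ((2 ^ n / 2 ^ e) ^ 2 + 2 ^ n / 2 ^ e) / 2 ∧
    (({γ | expSum k p.1 p.2 γ = -2 ^ e} : Set F).ncard : ℚ) =
      ((2 ^ n / 2 ^ e) ^ 2 - 2 ^ n / 2 ^ e) / 2 ∧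
    (({γ | expSum k p.1 p.2 γ = 0} : Set F).ncard : ℚ) = 2 ^ n - (2 ^ n / 2 ^ e) ^ 2 := by
  simp only [expSum_eq_linTwist]
  have h := card_linTwist_eq
    (fun x => p.1 * (x * frobOver F k (frobOver F k x)) + p.2 * (x * frobOver F k x))
    (polarOp (frobOver F k) p.1 p.2).toAddMonoidHom
    (fun x z => addChi_quadratic_add (frobOver F k) p.1 p.2 x z)
    (by simp [addChi_zero]) (2 ^ e) (by positivity) ?_
  · rw [hF] at h
    push_cast at h
    exact h
  · have : Nat.card (polarOp (frobOver F k) p.1 p.2).toAddMonoidHom.ker =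
        Nat.card (LinearMap.ker (polarOp (frobOver F k) p.1 p.2)) := rfl
    rw [this, Module.natCard_eq_pow_finrank (K := frobFixed F k), hr, card_frobFixed hn hF, hF]
    push_cast
    rw [← pow_mul, ← pow_add, he, pow_mul']

end FixedField

/-! ### The value distribution and its closed form. -/

/-- The odd number n/d cannot be 1, since 0 < k < n, nor 3, since then k would be n/3 or 2n/3.
Writing it as 2s + 5 makes (n + d)/2 = d(s + 3) and (n + 3d)/2 = d(s + 4). -/
theorem exists_eq_gcd_mul {n k : ℕ} (hk1 : 1 ≤ k) (hkn : k ≤ n - 1) (hodd : Odd (n / n.gcd k))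
    (hk3 : 3 * k ≠ n) (hk32 : 3 * k ≠ 2 * n) : ∃ s, n = n.gcd k * (2 * s + 5) := by
  obtain ⟨a, ha⟩ := Nat.gcd_dvd_left n k
  obtain ⟨b, hb⟩ := Nat.gcd_dvd_right n k
  have hd : 0 < n.gcd k := Nat.gcd_pos_of_pos_right _ hk1
  generalize n.gcd k = d at *
  have hna : n / d = a := by rw [ha, Nat.mul_div_cancel_left _ hd]
  rw [hna] at hodd
  obtain ⟨t, rfl⟩ := hodd
  have hba : b < 2 * t + 1 := by
    refine lt_of_mul_lt_mul_left (a := d) ?_ (Nat.zero_le _)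
    omega
  have hb0 : b ≠ 0 := by
    rintro rfl
    omega
  rcases t with _ | _ | s
  · omega
  · interval_cases b <;> omega
  · exact ⟨s, ha.trans (by ring)⟩

/-- Each nonzero value arises from only one class of pairs (α, β): the zero pair, nullity 1, or
nullity 3. The value 0 arises from all three. -/
theorem valueMult_eq {F : Type*} [Field F] [Fintype F] [Algebra (ZMod 2) F]
    {n k d s : ℕ} (hF : Fintype.card F = 2 ^ n) (hn0 : n ≠ 0) (hd : d = Nat.gcd n k)
    (hs : n = d * (2 * s + 5)) (N₁ N₃ : ℚ)
    (hN₃ : N₃ = (2 ^ n - 1) * (2 ^ n / 2 ^ d - 1) / ((2 ^ d) ^ 2 - 1))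
    (hN₁ : N₁ = (2 ^ n) ^ 2 - 1 - (2 ^ n - 1) * (2 ^ n / 2 ^ d - 1) / ((2 ^ d) ^ 2 - 1)) :
    (∀ α β γ : F, expSum k α β γ ∈
        ({2 ^ (d * (s + 3)), -2 ^ (d * (s + 3)), 2 ^ (d * (s + 4)), -2 ^ (d * (s + 4)),
          0, 2 ^ n} : Set ℤ)) ∧
      (valueMult F k (2 ^ (d * (s + 3))) : ℚ) =
        N₁ * (((2 ^ n / 2 ^ (d * (s + 3))) ^ 2 + 2 ^ n / 2 ^ (d * (s + 3))) / 2) ∧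
      (valueMult F k (-2 ^ (d * (s + 3))) : ℚ) =
        N₁ * (((2 ^ n / 2 ^ (d * (s + 3))) ^ 2 - 2 ^ n / 2 ^ (d * (s + 3))) / 2) ∧
      (valueMult F k (2 ^ (d * (s + 4))) : ℚ) =
        N₃ * (((2 ^ n / 2 ^ (d * (s + 4))) ^ 2 + 2 ^ n / 2 ^ (d * (s + 4))) / 2) ∧
      (valueMult F k (-2 ^ (d * (s + 4))) : ℚ) =
        N₃ * (((2 ^ n / 2 ^ (d * (s + 4))) ^ 2 - 2 ^ n / 2 ^ (d * (s + 4))) / 2) ∧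
      (valueMult F k 0 : ℚ) = 2 ^ n - 1 + N₁ * (2 ^ n - (2 ^ n / 2 ^ (d * (s + 3))) ^ 2) +
        N₃ * (2 ^ n - (2 ^ n / 2 ^ (d * (s + 4))) ^ 2) ∧
      valueMult F k (2 ^ n) = 1 := by
  classical
  have hd0 : 0 < n.gcd k := Nat.gcd_pos_of_pos_left _ (by omega)
  have hσ : ∀ x : F, frobOver F k x = x →
      x ∈ Set.range (algebraMap (frobFixed F k) F) := fun x hx =>
    ⟨⟨x, mem_frobFixed.2 ((frobOver_apply k x).symm.trans hx)⟩, rfl⟩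
  have hcF : CharP F 2 := charP_of_injective_algebraMap (algebraMap (ZMod 2) F).injective 2
  have hcK : CharP (frobFixed F k) 2 :=
    charP_of_injective_algebraMap (algebraMap (ZMod 2) (frobFixed F k)).injective 2
  have hodd' : Odd (Module.finrank (frobFixed F k) F) := by
    rw [finrank_frobFixed hF, ← hd, hs, Nat.mul_div_cancel_left _ (hd ▸ hd0)]
    exact ⟨s + 2, by ring⟩
  obtain ⟨hN3, hN1⟩ := ncard_finrank_ker_polarOp (frobOver F k) hσ hodd'
  rw [card_frobFixed hn0 hF, Nat.card_eq_fintype_card, hF, ← hd] at hN3 hN1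
  rw [← hd] at hd0
  have hr : ∀ p : F × F, p ≠ 0 → _ := fun p hp => finrank_ker_polarOp (frobOver F k) hσ hodd' hp
  have hC1 := fun (p : F × F) hp => card_expSum_eq hn0 hF k 1 (d * (s + 3)) (p := p)
    (by rw [← hd]; nlinarith [hs]) hp
  have hC3 := fun (p : F × F) hp => card_expSum_eq hn0 hF k 3 (d * (s + 4)) (p := p)
    (by rw [← hd]; nlinarith [hs]) hp
  have l13 : d * (s + 3) < d * (s + 4) := Nat.mul_lt_mul_of_pos_left (by omega) hd0
  -- Here n/d ≥ 5 is needed: for n/d = 3 the value 2^((n + 3d)/2) would coincide with 2^n.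
  have l3n : d * (s + 4) < n := by
    rw [hs]; exact Nat.mul_lt_mul_of_pos_left (by omega) hd0
  have p13 : (2 : ℤ) ^ (d * (s + 3)) < 2 ^ (d * (s + 4)) := pow_lt_pow_right₀ (by norm_num) l13
  have p3n : (2 : ℤ) ^ (d * (s + 4)) < 2 ^ n := pow_lt_pow_right₀ (by norm_num) l3n
  have p1 : (0 : ℤ) < 2 ^ (d * (s + 3)) := by positivity
  have hE0 (γ : F) : expSum k 0 0 γ = if γ = 0 then (2 : ℤ) ^ n else 0 := by
    rw [expSum_zero_zero, hF]; push_cast; rfl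
  have hempty : ∀ v : ℤ, v ≠ 2 ^ n → v ≠ 0 →
      (({γ | expSum k 0 0 γ = v} : Set F).ncard : ℚ) = 0 := by
    intro v hv hv0
    rw [Nat.cast_eq_zero, Set.ncard_eq_zero, Set.eq_empty_iff_forall_notMem]
    intro γ hγ
    rw [Set.mem_ofPred_eq, hE0] at hγ
    split_ifs at hγ
    · exact hv hγ.symm
    · exact hv0 hγ.symm
  have hnot1 : ∀ v : ℤ, v ≠ 2 ^ (d * (s + 3)) → v ≠ -2 ^ (d * (s + 3)) → v ≠ 0 →
      ∀ p : F × F, p ≠ 0 → Module.finrank (frobFixed F k)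
        (LinearMap.ker (polarOp (frobOver F k) p.1 p.2)) = 1 →
      (({γ | expSum k p.1 p.2 γ = v} : Set F).ncard : ℚ) = 0 := by
    intro v h1 h2 h0 p _ hp
    rw [Nat.cast_eq_zero, Set.ncard_eq_zero, Set.eq_empty_iff_forall_notMem]
    rintro γ rfl
    rcases (hC1 p hp).1 γ with h | h | h
    exacts [h1 h, h2 h, h0 h]
  have hnot3 : ∀ v : ℤ, v ≠ 2 ^ (d * (s + 4)) → v ≠ -2 ^ (d * (s + 4)) → v ≠ 0 →
      ∀ p : F × F, p ≠ 0 → Module.finrank (frobFixed F k)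
        (LinearMap.ker (polarOp (frobOver F k) p.1 p.2)) = 3 →
      (({γ | expSum k p.1 p.2 γ = v} : Set F).ncard : ℚ) = 0 := by
    intro v h1 h2 h0 p _ hp
    rw [Nat.cast_eq_zero, Set.ncard_eq_zero, Set.eq_empty_iff_forall_notMem]
    rintro γ rfl
    rcases (hC3 p hp).1 γ with h | h | h
    exacts [h1 h, h2 h, h0 h]
  push_cast at hN1 hN3
  rw [← hN₁] at hN1
  rw [← hN₃] at hN3
  have hv := fun v w₀ w₁ w₃ => valueMult_eq_of_classes (F := F) k v w₀ w₁ w₃ hr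
  rw [hN1, hN3] at hv
  generalize (2 : ℤ) ^ (d * (s + 3)) = M₁ at *
  generalize (2 : ℤ) ^ (d * (s + 4)) = M₃ at *
  generalize (2 : ℤ) ^ n = Q at *
  refine ⟨?_, ?_, ?_, ?_, ?_, ?_, ?_⟩
  · intro α β γ
    simp only [Set.mem_insert_iff, Set.mem_singleton_iff]
    by_cases h : (α, β) = 0
    · obtain ⟨rfl, rfl⟩ := Prod.mk.inj h
      rw [hE0]
      split_ifs
      · tauto
      · tauto
    · rcases hr (α, β) h with h' | h'
      · have := (hC1 (α, β) h').1 γ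
        tauto
      · have := (hC3 (α, β) h').1 γ
        tauto
  · have := hv (M₁) _ _ _ (hempty _ (by omega) (by omega)) (fun p _ hp => (hC1 p hp).2.1)
      (hnot3 _ (by omega) (by omega) (by omega))
    rwa [mul_zero, zero_add, add_zero] at this
  · have := hv (-M₁) _ _ _ (hempty _ (by omega) (by omega)) (fun p _ hp => (hC1 p hp).2.2.1)
      (hnot3 _ (by omega) (by omega) (by omega))
    rwa [mul_zero, zero_add, add_zero] at this
  · have := hv (M₃) _ _ _ (hempty _ (by omega) (by omega))
      (hnot1 _ (by omega) (by omega) (by omega)) (fun p _ hp => (hC3 p hp).2.1)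
    rwa [mul_zero, zero_add, zero_add] at this
  · have := hv (-M₃) _ _ _ (hempty _ (by omega) (by omega))
      (hnot1 _ (by omega) (by omega) (by omega)) (fun p _ hp => (hC3 p hp).2.2.1)
    rwa [mul_zero, zero_add, zero_add] at this
  · have h0 : (({γ | expSum k 0 0 γ = 0} : Set F).ncard : ℚ) = 2 ^ n - 1 := by
      have : ({γ | expSum k 0 0 γ = 0} : Set F) = {0}ᶜ := by
        ext γ
        rw [Set.mem_ofPred_eq, hE0]
        simp only [Set.mem_compl_iff, Set.mem_singleton_iff]
        split_ifs <;> [(constructor <;> [omega; tauto]); tauto]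
      rw [this, Set.ncard_compl, Set.ncard_singleton, Nat.card_eq_fintype_card, hF,
        Nat.cast_sub Nat.one_le_two_pow]
      push_cast; rfl
    exact hv 0 _ _ _ h0 (fun p _ hp => (hC1 p hp).2.2.2) (fun p _ hp => (hC3 p hp).2.2.2)
  · have h0 : (({γ | expSum k 0 0 γ = Q} : Set F).ncard : ℚ) = 1 := by
      have : ({γ | expSum k 0 0 γ = Q} : Set F) = {0} := by
        ext γ
        rw [Set.mem_ofPred_eq, hE0]
        simp only [Set.mem_singleton_iff]
        split_ifs <;> [tauto; (constructor <;> [omega; tauto])]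
      rw [this, Set.ncard_singleton, Nat.cast_one]
    have := hv _ _ _ _ h0
      (hnot1 _ (by omega) (by omega) (by omega)) (hnot3 _ (by omega) (by omega) (by omega))
    rw [mul_zero, mul_zero, add_zero, add_zero] at this
    exact_mod_cast this

theorem expSum_distribution {F : Type*} [Field F] [Fintype F] [Algebra (ZMod 2) F]
    (n k d : ℕ) (hF : Fintype.card F = 2 ^ n)
    (hk1 : 1 ≤ k) (hkn : k ≤ n - 1) (hd : d = Nat.gcd n k) (hodd : Odd (n / d))
    (hk3 : 3 * k ≠ n) (hk32 : 3 * k ≠ 2 * n) :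
    (∀ α β γ : F, expSum k α β γ ∈
        ({2 ^ ((n + d) / 2), -2 ^ ((n + d) / 2), 2 ^ ((n + 3 * d) / 2), -2 ^ ((n + 3 * d) / 2),
          0, 2 ^ n} : Set ℤ)) ∧
      (valueMult F k (2 ^ ((n + d) / 2)) : ℚ) =
        (2 ^ (n - d - 1) + 2 ^ ((n - d - 2) / 2)) * (2 ^ n - 1) *
          (2 ^ (n + 2 * d) - 2 ^ n - 2 ^ (n - d) + 2 ^ (2 * d)) / (2 ^ (2 * d) - 1) ∧
      (valueMult F k (-2 ^ ((n + d) / 2)) : ℚ) =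
        (2 ^ (n - d - 1) - 2 ^ ((n - d - 2) / 2)) * (2 ^ n - 1) *
          (2 ^ (n + 2 * d) - 2 ^ n - 2 ^ (n - d) + 2 ^ (2 * d)) / (2 ^ (2 * d) - 1) ∧
      (valueMult F k (2 ^ ((n + 3 * d) / 2)) : ℚ) =
        (2 ^ (n - 3 * d - 1) + 2 ^ ((n - 3 * d - 2) / 2)) * (2 ^ (n - d) - 1) * (2 ^ n - 1) /
          (2 ^ (2 * d) - 1) ∧
      (valueMult F k (-2 ^ ((n + 3 * d) / 2)) : ℚ) =
        (2 ^ (n - 3 * d - 1) - 2 ^ ((n - 3 * d - 2) / 2)) * (2 ^ (n - d) - 1) * (2 ^ n - 1) /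
          (2 ^ (2 * d) - 1) ∧
      (valueMult F k 0 : ℚ) =
        (2 ^ n - 1) * (2 ^ (2 * n) - 2 ^ (2 * n - d) + 2 ^ (2 * n - 4 * d) + 2 ^ n - 2 ^ (n - d)
          - 2 ^ (n - 3 * d) + 1) ∧
      valueMult F k (2 ^ n) = 1 := by
  classical
  obtain ⟨s, hs⟩ := exists_eq_gcd_mul hk1 hkn (hd ▸ hodd) hk3 hk32
  have hd0 : 0 < d := hd ▸ Nat.gcd_pos_of_pos_right _ hk1
  rw [← hd] at hs
  have x1 : (n + d) / 2 = d * (s + 3) := by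
    rw [hs]; exact Nat.div_eq_of_eq_mul_right two_pos (by ring)
  have x3 : (n + 3 * d) / 2 = d * (s + 4) := by
    rw [hs]; exact Nat.div_eq_of_eq_mul_right two_pos (by ring)
  have hy0 : (2 : ℚ) ^ d ≠ 0 := by positivity
  have hy1 : ((2 : ℚ) ^ d) ^ 2 - 1 ≠ 0 := by
    have : (1 : ℚ) < 2 ^ d := one_lt_pow₀ (by norm_num) (by omega)
    nlinarith
  have hz0 : (2 : ℚ) ^ (d * s) ≠ 0 := by positivity
  -- With y = 2^d and z = 2^(ds), every power in the table becomes a monomial, up to a factor 1/2,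
  -- and the multiplicities become identities of rational functions in y and z.
  have hq : (2 : ℚ) ^ n = (2 ^ (d * s)) ^ 2 * (2 ^ d) ^ 5 := by rw [hs]; ring
  have hpred : ∀ a b : ℕ, a = b + 1 → (2 : ℚ) ^ b = 2 ^ a / 2 := by
    rintro _ b rfl; rw [pow_succ]; ring
  have hds : d * (s + 1) = d * s + d := by ring
  have hds2 : d * (s + 2) = d * s + 2 * d := by ring
  have hns : n = 2 * (d * s) + 5 * d := by rw [hs]; ring
  have f1 : (2 : ℚ) ^ (n - d - 1) = (2 ^ (d * s)) ^ 2 * (2 ^ d) ^ 4 / 2 := by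
    rw [hpred (d * (2 * s + 4)) _ (by rw [mul_add, mul_left_comm]; omega)]; ring
  have f2 : (2 : ℚ) ^ ((n - d - 2) / 2) = 2 ^ (d * s) * (2 ^ d) ^ 2 / 2 := by
    rw [hpred (d * (s + 2)) _ (by omega)]; ring
  have f3 : (2 : ℚ) ^ (n - 3 * d - 1) = (2 ^ (d * s)) ^ 2 * (2 ^ d) ^ 2 / 2 := by
    rw [hpred (d * (2 * s + 2)) _ (by rw [mul_add, mul_left_comm]; omega)]; ring
  have f4 : (2 : ℚ) ^ ((n - 3 * d - 2) / 2) = 2 ^ (d * s) * 2 ^ d / 2 := by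
    rw [hpred (d * (s + 1)) _ (by omega)]; ring
  have f5 : (2 : ℚ) ^ (n - d) = (2 ^ (d * s)) ^ 2 * (2 ^ d) ^ 4 := by
    rw [show n - d = 2 * (d * s) + 4 * d by omega]; ring
  have f6 : (2 : ℚ) ^ (n - 3 * d) = (2 ^ (d * s)) ^ 2 * (2 ^ d) ^ 2 := by
    rw [show n - 3 * d = 2 * (d * s) + 2 * d by omega]; ring
  have f7 : (2 : ℚ) ^ (2 * n - d) = (2 ^ (d * s)) ^ 4 * (2 ^ d) ^ 9 := by
    rw [show 2 * n - d = 4 * (d * s) + 9 * d by omega]; ring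
  have f8 : (2 : ℚ) ^ (2 * n - 4 * d) = (2 ^ (d * s)) ^ 4 * (2 ^ d) ^ 6 := by
    rw [show 2 * n - 4 * d = 4 * (d * s) + 6 * d by omega]; ring
  have f9 : (2 : ℚ) ^ (2 * n) = (2 ^ (d * s)) ^ 4 * (2 ^ d) ^ 10 := by
    rw [show 2 * n = 4 * (d * s) + 10 * d by omega]; ring
  have f10 : (2 : ℚ) ^ (2 * d) = (2 ^ d) ^ 2 := by ring
  have f11 : (2 : ℚ) ^ (n + 2 * d) = (2 ^ (d * s)) ^ 2 * (2 ^ d) ^ 7 := by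
    rw [show n + 2 * d = 2 * (d * s) + 7 * d by omega]; ring
  have f12 : (2 : ℚ) ^ n / 2 ^ (d * (s + 3)) = 2 ^ (d * s) * (2 ^ d) ^ 2 := by
    rw [hq, mul_add, pow_add, div_eq_iff (by positivity)]; ring
  have f13 : (2 : ℚ) ^ n / 2 ^ (d * (s + 4)) = 2 ^ (d * s) * 2 ^ d := by
    rw [hq, mul_add, pow_add, div_eq_iff (by positivity)]; ring
  obtain ⟨h, h1, h2, h3, h4, h5, h6⟩ := valueMult_eq hF (by omega) hd hs _ _ rfl rfl
  rw [x1, x3, h1, h2, h3, h4, h5]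
  refine ⟨h, ?_, ?_, ?_, ?_, ?_, h6⟩
  all_goals
    simp only [f1, f2, f3, f4, f5, f6, f7, f8, f9, f10, f11, f12, f13]
    rw [hq]
    clear * - hy0 hy1 hz0
    generalize (2 : ℚ) ^ d = y at *
    generalize (2 : ℚ) ^ (d * s) = z at *
    field_simp <;> ring

/-! ### The cyclic code and its parametrization by trace words. -/

section Words

theorem coeff_wordPoly {l : ℕ} (c : Fin l → ZMod 2) (i : Fin l) : (wordPoly l c).coeff i = c i := by
  simp only [wordPoly, finsetSum_coeff, coeff_C_mul_X_pow]
  rw [Finset.sum_eq_single i (fun j _ hj => if_neg fun h => hj (Fin.ext h.symm)) (by simp)]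
  simp

theorem wordPoly_injective (l : ℕ) : Function.Injective (wordPoly l) := fun c c' h =>
  funext fun i => by rw [← coeff_wordPoly c, h, coeff_wordPoly]

theorem degree_wordPoly_lt {l : ℕ} (c : Fin l → ZMod 2) : (wordPoly l c).degree < l :=
  (degree_sum_le _ _).trans_lt <| (Finset.sup_lt_iff (WithBot.bot_lt_coe l)).2 fun i _ =>
    (degree_C_mul_X_pow_le _ _).trans_lt (WithBot.coe_lt_coe.2 i.2)

/-- If X^l - 1 = hg, a codeword is a multiple of g, and its quotient by g has degree less than deg
h. -/
theorem card_cyclicCode_le {l : ℕ} (hl : l ≠ 0) {h : (ZMod 2)[X]} (hdvd : h ∣ X ^ l - 1) :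
    Nat.card (cyclicCode l h) ≤ 2 ^ h.natDegree := by
  obtain ⟨g, hg⟩ := hdvd
  have hne : (X ^ l - 1 : (ZMod 2)[X]) ≠ 0 := by
    simpa using X_pow_sub_C_ne_zero (R := ZMod 2) (Nat.pos_of_ne_zero hl) 1
  have hh : h ≠ 0 := fun h0 => hne (by rw [hg, h0, zero_mul])
  have hg0 : g ≠ 0 := fun h0 => hne (by rw [hg, h0, mul_zero])
  have hdeg : (l : WithBot ℕ) = h.degree + g.degree := by
    rw [← degree_mul, ← hg]
    simpa using (degree_X_pow_sub_C (R := ZMod 2) (Nat.pos_of_ne_zero hl) 1).symm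
  have hdiv (c : cyclicCode l h) : ∃ u : (ZMod 2)[X], wordPoly l c = g * u := by
    have hc : (X ^ l - 1 : (ZMod 2)[X]) ∣ wordPoly l c * h := c.2
    rw [hg, mul_comm h] at hc
    exact (mul_dvd_mul_iff_right hh).1 hc
  choose u hu using hdiv
  have hudeg (c : cyclicCode l h) : (u c).degree < h.natDegree := by
    have := degree_wordPoly_lt c.1
    rw [hu, hdeg, degree_mul, add_comm, degree_eq_natDegree hg0] at this
    rw [← degree_eq_natDegree hh]
    exact lt_of_add_lt_add_right this
  have hinj : Function.Injective fun (c : cyclicCode l h) (i : Fin h.natDegree) =>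
      (u c).coeff i := by
    intro c c' hcc
    have : u c = u c' := by
      ext i
      rcases lt_or_ge i h.natDegree with hi | hi
      · exact congrFun hcc ⟨i, hi⟩
      · rw [coeff_eq_zero_of_degree_lt ((hudeg c).trans_le (by exact_mod_cast hi)),
          coeff_eq_zero_of_degree_lt ((hudeg c').trans_le (by exact_mod_cast hi))]
    exact Subtype.ext (wordPoly_injective l (by rw [hu, hu, this]))
  have := Nat.card_le_card_of_injective _ hinj
  simpa using this

variable {F : Type*} [Field F]

/-- The geometric sum times θX - 1 is X^l - 1, and θX - 1 is a scalar multiple of the factor X - θ⁻¹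
of g. This is why inverses appear in the check polynomial. -/
theorem X_pow_sub_one_dvd_geom_mul {l : ℕ} {θ : F} (hθ : θ ^ l = 1) (hθ0 : θ ≠ 0) (a : F) {g : F[X]}
    (hg : g.IsRoot θ⁻¹) :
    (X ^ l - 1 : F[X]) ∣ (∑ i : Fin l, C (a * θ ^ (i : ℕ)) * X ^ (i : ℕ)) * g := by
  obtain ⟨g', rfl⟩ := dvd_iff_isRoot.2 hg
  rw [← mul_assoc]
  refine Dvd.dvd.mul_right ⟨C (a * θ⁻¹), ?_⟩ _
  have h1 : ∑ i : Fin l, C (a * θ ^ (i : ℕ)) * X ^ (i : ℕ) =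
      C a * ∑ i ∈ Finset.range l, (C θ * X) ^ i := by
    rw [Finset.mul_sum, ← Fin.sum_univ_eq_sum_range (fun i => C a * (C θ * X) ^ i)]
    refine Finset.sum_congr rfl fun i _ => ?_
    rw [C_mul, C_pow, mul_pow]
    ring
  have h2 : (X - C θ⁻¹ : F[X]) = C θ⁻¹ * (C θ * X - 1) := by
    rw [mul_sub, ← mul_assoc, ← C_mul, inv_mul_cancel₀ hθ0, C_1]; ring
  have h3 := geom_sum_mul (C θ * X) l
  rw [mul_pow, ← C_pow, hθ, C_1, one_mul] at h3
  rw [h1, h2, ← h3, C_mul]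
  ring

variable [Fintype F]

theorem sum_eq_add_sum_pow_primitiveRoot {l : ℕ} {π : F} (hl : l ≠ 0) (hπ : IsPrimitiveRoot π l)
    (hF : Fintype.card F = l + 1) (g : F → ℤ) :
    ∑ x, g x = g 0 + ∑ i : Fin l, g (π ^ (i : ℕ)) := by
  classical
  rw [← Finset.add_sum_erase _ _ (Finset.mem_univ 0)]
  congr 1
  have hinj : Function.Injective fun i : Fin l => π ^ (i : ℕ) := fun i j h =>
    Fin.ext (hπ.pow_inj i.2 j.2 h)
  have himg : Finset.univ.erase (0 : F) = Finset.univ.image fun i : Fin l => π ^ (i : ℕ) := by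
    refine (Finset.eq_of_subset_of_card_le ?_ ?_).symm
    · intro x hx
      obtain ⟨i, -, rfl⟩ := Finset.mem_image.1 hx
      exact Finset.mem_erase.2 ⟨pow_ne_zero _ (hπ.ne_zero hl), Finset.mem_univ _⟩
    · rw [Finset.card_image_of_injective _ hinj, Finset.card_erase_of_mem (Finset.mem_univ _),
        Finset.card_univ, hF, Finset.card_univ, Fintype.card_fin, Nat.add_sub_cancel]
  rw [himg, Finset.sum_image fun i _ j _ h => hinj h]

variable [Algebra (ZMod 2) F]

/-- Over F the trace splits the word into geometric words with ratios θ^(2^j), and g, having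
coefficients in 𝔽₂, vanishes at every conjugate of θ⁻¹. Divisibility then descends to 𝔽₂. -/
theorem X_pow_sub_one_dvd_trace_word_mul {l : ℕ} {θ : F} (hθ : θ ^ l = 1) (hθ0 : θ ≠ 0) (a : F)
    {g : (ZMod 2)[X]} (hg : aeval θ⁻¹ g = 0) :
    (X ^ l - 1 : (ZMod 2)[X]) ∣
      wordPoly l (fun i => Algebra.trace (ZMod 2) F (a * θ ^ (i : ℕ))) * g := by
  rw [← map_dvd_map' (algebraMap (ZMod 2) F), Polynomial.map_mul]
  have h1 : (wordPoly l (fun i => Algebra.trace (ZMod 2) F (a * θ ^ (i : ℕ)))).map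
      (algebraMap (ZMod 2) F) = ∑ j ∈ Finset.range (Module.finrank (ZMod 2) F),
        ∑ i : Fin l, C (a ^ 2 ^ j * (θ ^ 2 ^ j) ^ (i : ℕ)) * X ^ (i : ℕ) := by
    rw [Finset.sum_comm]
    simp only [wordPoly, Polynomial.map_sum, Polynomial.map_mul, map_C, Polynomial.map_pow, map_X,
      FiniteField.algebraMap_trace_eq_sum_pow, Nat.card_zmod, map_sum, Finset.sum_mul]
    refine Finset.sum_congr rfl fun i _ => Finset.sum_congr rfl fun j _ => ?_
    rw [mul_pow, ← pow_mul, ← pow_mul, mul_comm (i : ℕ)]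
  rw [h1, Finset.sum_mul]
  simp only [Polynomial.map_sub, Polynomial.map_pow, map_X, Polynomial.map_one]
  refine Finset.dvd_sum fun j _ => X_pow_sub_one_dvd_geom_mul ?_ (pow_ne_zero _ hθ0) _ ?_
  · rw [← pow_mul, mul_comm, pow_mul, hθ, one_pow]
  · have := aeval_algHom_apply
      ((FiniteField.frobeniusAlgEquivOfAlgebraic (ZMod 2) F ^ j).toAlgHom) θ⁻¹ g
    rw [hg, map_zero] at this
    rw [IsRoot.def, eval_map_algebraMap, ← inv_pow, ← frobenius_pow_apply]
    exact this

/-- An arbitrary common multiple h is allowed because both the product and the least common multiple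
of the three minimal polynomials are needed. -/
theorem codeWord_mem_cyclicCode {l k : ℕ} {π : F} (hπ : π ^ l = 1) (hπ0 : π ≠ 0) (α β γ : F)
    {h : (ZMod 2)[X]} (h1 : minpoly (ZMod 2) π⁻¹ ∣ h)
    (h2 : minpoly (ZMod 2) (π⁻¹ ^ (2 ^ k + 1)) ∣ h)
    (h3 : minpoly (ZMod 2) (π⁻¹ ^ (2 ^ (2 * k) + 1)) ∣ h) :
    codeWord l k π α β γ ∈ cyclicCode l h := by
  have key (e : ℕ) (he : minpoly (ZMod 2) (π⁻¹ ^ e) ∣ h) (a : F) :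
      (fun i : Fin l => Algebra.trace (ZMod 2) F (a * π ^ ((i : ℕ) * e))) ∈ cyclicCode l h := by
    have := X_pow_sub_one_dvd_trace_word_mul (l := l) (θ := π ^ e) (g := h)
      (by rw [← pow_mul, mul_comm, pow_mul, hπ, one_pow]) (pow_ne_zero _ hπ0) a
      (by rw [← inv_pow]; exact (minpoly.dvd_iff).1 he)
    simp only [← pow_mul, mul_comm e] at this
    exact this
  have hsum : codeWord l k π α β γ =
      (fun i : Fin l => Algebra.trace (ZMod 2) F (α * π ^ ((i : ℕ) * (2 ^ (2 * k) + 1)))) +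
      (fun i : Fin l => Algebra.trace (ZMod 2) F (β * π ^ ((i : ℕ) * (2 ^ k + 1)))) +
      (fun i : Fin l => Algebra.trace (ZMod 2) F (γ * π ^ ((i : ℕ) * 1))) := by
    funext i
    simp [codeWord]
  rw [hsum]
  exact add_mem (add_mem (key _ h3 α) (key _ h2 β)) (key 1 (by rwa [pow_one]) γ)

theorem expSum_eq_sum_codeWord {l : ℕ} (k : ℕ) {π : F} (hl : l ≠ 0) (hπ : IsPrimitiveRoot π l)
    (hF : Fintype.card F = l + 1) (α β γ : F) :
    expSum k α β γ = 1 + ∑ i : Fin l, (-1) ^ (codeWord l k π α β γ i).val := by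
  rw [expSum, sum_eq_add_sum_pow_primitiveRoot hl hπ hF]
  congr 1
  · simp [addChi_zero]
  · refine Finset.sum_congr rfl fun i _ => ?_
    simp only [addChi, codeWord, pow_mul]

theorem two_mul_hammingNorm_codeWord {l : ℕ} (k : ℕ) {π : F} (hl : l ≠ 0)
    (hπ : IsPrimitiveRoot π l) (hF : Fintype.card F = l + 1) (α β γ : F) :
    2 * (hammingNorm (codeWord l k π α β γ) : ℤ) = Fintype.card F - expSum k α β γ := by
  rw [expSum_eq_sum_codeWord k hl hπ hF, hF, hammingNorm]
  have key : ∀ a : ZMod 2, (-1 : ℤ) ^ a.val = 1 - 2 * if a ≠ 0 then 1 else 0 := by decide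
  simp only [key, Finset.sum_sub_distrib, ← Finset.mul_sum, Finset.sum_boole]
  simp
  ring

/-- A zero word has weight 0, so its sum equals q, which by `h1` happens for a single triple.
Linearity of the word in the triple does the rest. -/
theorem codeWord_injective {l k : ℕ} {π : F} (hl : l ≠ 0) (hπ : IsPrimitiveRoot π l)
    (hF : Fintype.card F = l + 1) (h1 : valueMult F k (Fintype.card F) = 1) :
    Function.Injective fun t : F × F × F => codeWord l k π t.1 t.2.1 t.2.2 := by
  have hval (t : F × F × F) (ht : codeWord l k π t.1 t.2.1 t.2.2 = 0) :
      expSum k t.1 t.2.1 t.2.2 = Fintype.card F := by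
    have := two_mul_hammingNorm_codeWord k hl hπ hF t.1 t.2.1 t.2.2
    rw [ht, hammingNorm_zero] at this
    push_cast at this
    linarith
  obtain ⟨t₀, ht₀⟩ := Set.ncard_eq_one.1 h1
  have huniq (t : F × F × F) (ht : codeWord l k π t.1 t.2.1 t.2.2 = 0) : t = t₀ := by
    have : t ∈ {t : F × F × F | expSum k t.1 t.2.1 t.2.2 = Fintype.card F} := hval t ht
    rwa [ht₀] at this
  intro t t' h
  have hsub : codeWord l k π (t - t').1 (t - t').2.1 (t - t').2.2 = 0 := by
    funext i
    have hi := congrFun h i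
    simp only [codeWord, map_add] at hi
    simp only [codeWord, Prod.fst_sub, Prod.snd_sub, sub_mul, map_add, map_sub, Pi.zero_apply]
    linear_combination hi
  have hz : codeWord l k π (0 : F × F × F).1 (0 : F × F × F).2.1 (0 : F × F × F).2.2 = 0 := by
    funext i
    simp [codeWord]
  exact sub_eq_zero.1 ((huniq _ hsub).trans (huniq 0 hz).symm)

/-- If the words `c(α, β, γ)` are pairwise distinct, they exhaust the cyclic code with
parity-check polynomial `checkPoly k π`, which then divides `X ^ l - 1`. -/
theorem bijOn_codeWord {l n k : ℕ} {π : F} (hl : l ≠ 0) (hπ : π ^ l = 1)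
    (hF : Fintype.card F = 2 ^ n)
    (hinj : Function.Injective fun t : F × F × F => codeWord l k π t.1 t.2.1 t.2.2) :
    checkPoly k π ∣ X ^ l - 1 ∧
      Set.BijOn (fun t : F × F × F => codeWord l k π t.1 t.2.1 t.2.2)
        Set.univ (cyclicCode l (checkPoly k π) : Set (Fin l → ZMod 2)) := by
  classical
  have hπ0 : π ≠ 0 := by
    rintro rfl
    rw [zero_pow hl] at hπ
    exact zero_ne_one hπ
  have hn : Module.finrank (ZMod 2) F = n := by
    have := Module.card_eq_pow_finrank (K := ZMod 2) (V := F)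
    rw [hF, ZMod.card] at this
    exact (Nat.pow_right_injective le_rfl this).symm
  have hcard : Nat.card (F × F × F) = 2 ^ (3 * n) := by
    rw [Nat.card_prod, Nat.card_prod, Nat.card_eq_fintype_card, hF]; ring
  have hm0 (x : F) : minpoly (ZMod 2) x ≠ 0 := minpoly.ne_zero_of_finite _ x
  have hmdeg (x : F) : (minpoly (ZMod 2) x).natDegree ≤ n := hn ▸ minpoly.natDegree_le x
  have hmdvd (e : ℕ) : minpoly (ZMod 2) (π⁻¹ ^ e) ∣ X ^ l - 1 := by
    refine minpoly.dvd _ _ ?_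
    rw [map_sub, map_pow, aeval_X, map_one, ← pow_mul, mul_comm, pow_mul, inv_pow, hπ, inv_one,
      one_pow, sub_self]
  -- The code with check polynomial h contains all q³ = 2^(3n) words but has at most 2^deg h
  -- elements.
  have hle {h : (ZMod 2)[X]} (hX : h ∣ X ^ l - 1)
      (h1 : minpoly (ZMod 2) π⁻¹ ∣ h) (h2 : minpoly (ZMod 2) (π⁻¹ ^ (2 ^ k + 1)) ∣ h)
      (h3 : minpoly (ZMod 2) (π⁻¹ ^ (2 ^ (2 * k) + 1)) ∣ h) : 3 * n ≤ h.natDegree := by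
    have h4 := Nat.card_le_card_of_injective
      (fun t : F × F × F => (⟨codeWord l k π t.1 t.2.1 t.2.2,
        codeWord_mem_cyclicCode hπ hπ0 _ _ _ h1 h2 h3⟩ : cyclicCode l h))
      (fun t t' e => hinj (Subtype.ext_iff.1 e))
    rw [hcard] at h4
    exact (Nat.pow_le_pow_iff_right (by norm_num)).1 (h4.trans (card_cyclicCode_le hl hX))
  have hprod0 : checkPoly k π ≠ 0 := mul_ne_zero (mul_ne_zero (hm0 _) (hm0 _)) (hm0 _)
  have hpdeg : (checkPoly k π).natDegree ≤ 3 * n := by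
    have := natDegree_mul_le (p := minpoly (ZMod 2) π⁻¹ * minpoly (ZMod 2) (π⁻¹ ^ (2 ^ k + 1)))
      (q := minpoly (ZMod 2) (π⁻¹ ^ (2 ^ (2 * k) + 1)))
    have h' := natDegree_mul_le (p := minpoly (ZMod 2) π⁻¹)
      (q := minpoly (ZMod 2) (π⁻¹ ^ (2 ^ k + 1)))
    have e1 := hmdeg π⁻¹
    have e2 := hmdeg (π⁻¹ ^ (2 ^ k + 1))
    have e3 := hmdeg (π⁻¹ ^ (2 ^ (2 * k) + 1))
    change natDegree (_ * _) ≤ _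
    omega
  have d1 : minpoly (ZMod 2) π⁻¹ ∣ checkPoly k π := (dvd_mul_right _ _).mul_right _
  have d2 : minpoly (ZMod 2) (π⁻¹ ^ (2 ^ k + 1)) ∣ checkPoly k π := (dvd_mul_left _ _).mul_right _
  have d3 : minpoly (ZMod 2) (π⁻¹ ^ (2 ^ (2 * k) + 1)) ∣ checkPoly k π := dvd_mul_left _ _
  have hX : checkPoly k π ∣ X ^ l - 1 := by
    -- The least common multiple divides X^l - 1 without any coprimality. By `hle` its degree is at
    -- least 3n, while the product has degree at most 3n, so the two differ by a unit.
    let h' := EuclideanDomain.lcm (EuclideanDomain.lcm (minpoly (ZMod 2) π⁻¹)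
      (minpoly (ZMod 2) (π⁻¹ ^ (2 ^ k + 1)))) (minpoly (ZMod 2) (π⁻¹ ^ (2 ^ (2 * k) + 1)))
    have hX' : h' ∣ X ^ l - 1 := EuclideanDomain.lcm_dvd
      (EuclideanDomain.lcm_dvd (by simpa using hmdvd 1) (hmdvd _)) (hmdvd _)
    obtain ⟨u, hu⟩ : h' ∣ checkPoly k π :=
      EuclideanDomain.lcm_dvd (EuclideanDomain.lcm_dvd d1 d2) d3
    have hdeg := hle hX'
      ((EuclideanDomain.dvd_lcm_left _ _).trans (EuclideanDomain.dvd_lcm_left _ _))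
      ((EuclideanDomain.dvd_lcm_right _ _).trans (EuclideanDomain.dvd_lcm_left _ _))
      (EuclideanDomain.dvd_lcm_right _ _)
    have hu0 : u ≠ 0 := fun h0 => hprod0 (by rw [hu, h0, mul_zero])
    have hh0 : h' ≠ 0 := fun h0 => hprod0 (by rw [hu, h0, zero_mul])
    have hudeg : u.natDegree = 0 := by
      rw [hu, natDegree_mul hh0 hu0] at hpdeg
      omega
    have hunit : IsUnit u := by
      rw [isUnit_iff_degree_eq_zero, degree_eq_natDegree hu0, hudeg]; rfl
    rw [hu]
    exact (hunit.mul_right_dvd).2 hX'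
  have hmaps : Set.MapsTo (fun t : F × F × F => codeWord l k π t.1 t.2.1 t.2.2)
      Set.univ (cyclicCode l (checkPoly k π) : Set (Fin l → ZMod 2)) := fun t _ =>
    codeWord_mem_cyclicCode hπ hπ0 _ _ _ d1 d2 d3
  refine ⟨hX, hmaps, hinj.injOn, ?_⟩
  have himg : (fun t : F × F × F => codeWord l k π t.1 t.2.1 t.2.2) '' Set.univ =
      (cyclicCode l (checkPoly k π) : Set (Fin l → ZMod 2)) := by
    refine Set.eq_of_subset_of_ncard_le hmaps.image_subset ?_
    rw [Set.ncard_image_of_injective _ hinj, Set.ncard_univ, hcard]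
    exact (card_cyclicCode_le hl hX).trans (Nat.pow_le_pow_right two_pos hpdeg)
  exact himg.ge

theorem weightMult_eq_valueMult {l k : ℕ} {π : F} (hl : l ≠ 0) (hπ : IsPrimitiveRoot π l)
    (hF : Fintype.card F = l + 1) {𝒞 : Submodule (ZMod 2) (Fin l → ZMod 2)}
    (hbij : Set.BijOn (fun t : F × F × F => codeWord l k π t.1 t.2.1 t.2.2)
        Set.univ (𝒞 : Set (Fin l → ZMod 2))) (v w : ℤ) (hvw : 2 * w = Fintype.card F - v) :
    weightMult 𝒞 w = valueMult F k v := by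
  have himg : {c : Fin l → ZMod 2 | c ∈ 𝒞 ∧ (hammingNorm c : ℤ) = w} =
      (fun t : F × F × F => codeWord l k π t.1 t.2.1 t.2.2) ''
        {t | expSum k t.1 t.2.1 t.2.2 = v} := by
    ext c
    constructor
    · rintro ⟨hc, hw⟩
      obtain ⟨t, -, rfl⟩ := hbij.surjOn hc
      refine ⟨t, ?_, rfl⟩
      have := two_mul_hammingNorm_codeWord k hl hπ hF t.1 t.2.1 t.2.2
      rw [hw] at this
      rw [Set.mem_ofPred_eq]
      linarith
    · rintro ⟨t, ht, rfl⟩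
      refine ⟨hbij.mapsTo (Set.mem_univ t), ?_⟩
      have := two_mul_hammingNorm_codeWord k hl hπ hF t.1 t.2.1 t.2.2
      rw [Set.mem_ofPred_eq] at ht
      rw [ht] at this
      linarith
  rw [weightMult, himg, (hbij.injOn.mono (Set.subset_univ _)).ncard_image]
  rfl

end Words

/-! ### Assembly: from values of the sum to weights of the code. -/

/-- Under the hypotheses `n / d` is an odd integer `≥ 5`, so `n ± d` and `n ± 3d` are even, `n - 3d ≥ 2`,
and every subtraction and division of natural numbers in an exponent below is exact. The
multiplicities are compared in `ℚ`, with true division. -/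
theorem mainTheorem1 {F : Type*} [Field F] [Fintype F] [Algebra (ZMod 2) F]
    (n k d : ℕ) (hF : Fintype.card F = 2 ^ n)
    (hk1 : 1 ≤ k) (hkn : k ≤ n - 1) (hd : d = Nat.gcd n k) (hodd : Odd (n / d))
    (hk3 : 3 * k ≠ n) (hk32 : 3 * k ≠ 2 * n)
    (π : F) (hπ : IsPrimitiveRoot π (2 ^ n - 1))
    (𝒞 : Submodule (ZMod 2) (Fin (2 ^ n - 1) → ZMod 2))
    (h𝒞 : 𝒞 = cyclicCode (2 ^ n - 1) (checkPoly k π)) :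
    -- the value distribution of the sum
    ((∀ α β γ : F, expSum k α β γ ∈
        ({2 ^ ((n + d) / 2), -2 ^ ((n + d) / 2), 2 ^ ((n + 3 * d) / 2), -2 ^ ((n + 3 * d) / 2),
          0, 2 ^ n} : Set ℤ)) ∧
      (valueMult F k (2 ^ ((n + d) / 2)) : ℚ) =
        (2 ^ (n - d - 1) + 2 ^ ((n - d - 2) / 2)) * (2 ^ n - 1) *
          (2 ^ (n + 2 * d) - 2 ^ n - 2 ^ (n - d) + 2 ^ (2 * d)) / (2 ^ (2 * d) - 1) ∧
      (valueMult F k (-2 ^ ((n + d) / 2)) : ℚ) =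
        (2 ^ (n - d - 1) - 2 ^ ((n - d - 2) / 2)) * (2 ^ n - 1) *
          (2 ^ (n + 2 * d) - 2 ^ n - 2 ^ (n - d) + 2 ^ (2 * d)) / (2 ^ (2 * d) - 1) ∧
      (valueMult F k (2 ^ ((n + 3 * d) / 2)) : ℚ) =
        (2 ^ (n - 3 * d - 1) + 2 ^ ((n - 3 * d - 2) / 2)) * (2 ^ (n - d) - 1) * (2 ^ n - 1) /
          (2 ^ (2 * d) - 1) ∧
      (valueMult F k (-2 ^ ((n + 3 * d) / 2)) : ℚ) =
        (2 ^ (n - 3 * d - 1) - 2 ^ ((n - 3 * d - 2) / 2)) * (2 ^ (n - d) - 1) * (2 ^ n - 1) /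
          (2 ^ (2 * d) - 1) ∧
      (valueMult F k 0 : ℚ) =
        (2 ^ n - 1) * (2 ^ (2 * n) - 2 ^ (2 * n - d) + 2 ^ (2 * n - 4 * d) + 2 ^ n - 2 ^ (n - d)
          - 2 ^ (n - 3 * d) + 1) ∧
      valueMult F k (2 ^ n) = 1) ∧
    -- the code, its parametrization by the words `c(α, β, γ)`, and the weights of these words
    (checkPoly k π ∣ X ^ (2 ^ n - 1) - 1 ∧
      Set.BijOn (fun t : F × F × F => codeWord (2 ^ n - 1) k π t.1 t.2.1 t.2.2)
        Set.univ (𝒞 : Set (Fin (2 ^ n - 1) → ZMod 2)) ∧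
      ∀ α β γ : F, (hammingNorm (codeWord (2 ^ n - 1) k π α β γ) : ℚ) =
        2 ^ (n - 1) - (1 / 2) * (expSum k α β γ : ℚ)) ∧
    -- the weight distribution of the code
    ((∀ c ∈ 𝒞, (hammingNorm c : ℤ) ∈
        ({2 ^ (n - 1) - 2 ^ ((n + d - 2) / 2), 2 ^ (n - 1) + 2 ^ ((n + d - 2) / 2),
          2 ^ (n - 1) - 2 ^ ((n + 3 * d - 2) / 2), 2 ^ (n - 1) + 2 ^ ((n + 3 * d - 2) / 2),
          2 ^ (n - 1), 0} : Set ℤ)) ∧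
      (weightMult 𝒞 (2 ^ (n - 1) - 2 ^ ((n + d - 2) / 2)) : ℚ) =
        (2 ^ (n - d - 1) + 2 ^ ((n - d - 2) / 2)) * (2 ^ n - 1) *
          (2 ^ (n + 2 * d) - 2 ^ n - 2 ^ (n - d) + 2 ^ (2 * d)) / (2 ^ (2 * d) - 1) ∧
      (weightMult 𝒞 (2 ^ (n - 1) + 2 ^ ((n + d - 2) / 2)) : ℚ) =
        (2 ^ (n - d - 1) - 2 ^ ((n - d - 2) / 2)) * (2 ^ n - 1) *
          (2 ^ (n + 2 * d) - 2 ^ n - 2 ^ (n - d) + 2 ^ (2 * d)) / (2 ^ (2 * d) - 1) ∧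
      (weightMult 𝒞 (2 ^ (n - 1) - 2 ^ ((n + 3 * d - 2) / 2)) : ℚ) =
        (2 ^ (n - 3 * d - 1) + 2 ^ ((n - 3 * d - 2) / 2)) * (2 ^ (n - d) - 1) * (2 ^ n - 1) /
          (2 ^ (2 * d) - 1) ∧
      (weightMult 𝒞 (2 ^ (n - 1) + 2 ^ ((n + 3 * d - 2) / 2)) : ℚ) =
        (2 ^ (n - 3 * d - 1) - 2 ^ ((n - 3 * d - 2) / 2)) * (2 ^ (n - d) - 1) * (2 ^ n - 1) /
          (2 ^ (2 * d) - 1) ∧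
      (weightMult 𝒞 (2 ^ (n - 1)) : ℚ) =
        (2 ^ n - 1) * (2 ^ (2 * n) - 2 ^ (2 * n - d) + 2 ^ (2 * n - 4 * d) + 2 ^ n - 2 ^ (n - d)
          - 2 ^ (n - 3 * d) + 1) ∧
      weightMult 𝒞 0 = 1) := by
  have hn1 : 1 ≤ n := by omega
  obtain ⟨s, hs⟩ := exists_eq_gcd_mul hk1 hkn (hd ▸ hodd) hk3 hk32
  rw [← hd] at hs
  have hns : n = 2 * (d * s) + 5 * d := by rw [hs]; ring
  have hd0 : 0 < d := hd ▸ Nat.gcd_pos_of_pos_right _ hk1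
  have hl : 2 ^ n - 1 ≠ 0 := by
    have : 2 ^ 1 ≤ 2 ^ n := Nat.pow_le_pow_right two_pos hn1
    omega
  have hF' : Fintype.card F = 2 ^ n - 1 + 1 := by
    rw [hF, Nat.sub_add_cancel Nat.one_le_two_pow]
  have hpow (a b : ℕ) (h : a = b + 1) : (2 : ℤ) ^ a = 2 * 2 ^ b := by rw [h, pow_succ']
  have hQ := hpow n (n - 1) (by omega)
  have hM₁ := hpow ((n + d) / 2) ((n + d - 2) / 2) (by omega)
  have hM₃ := hpow ((n + 3 * d) / 2) ((n + 3 * d - 2) / 2) (by omega)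
  have hdist := expSum_distribution (F := F) n k d hF hk1 hkn hd hodd hk3 hk32
  obtain ⟨hval, v1, v2, v3, v4, v5, v6⟩ := hdist
  have hinj := codeWord_injective (k := k) hl hπ hF' (by rw [hF]; exact_mod_cast v6)
  have hbij := bijOn_codeWord hl hπ.pow_eq_one hF hinj
  rw [← h𝒞] at hbij
  have hwt (α β γ : F) := two_mul_hammingNorm_codeWord k hl hπ hF' α β γ
  -- The relation 2w = q - v matches weights with values, so each weight multiplicity is read off
  -- from the value distribution.
  have hmult (v w : ℤ) (h : 2 * w = 2 ^ n - v) : weightMult 𝒞 w = valueMult F k v :=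
    weightMult_eq_valueMult hl hπ hF' hbij.2 v w (by rw [hF]; exact_mod_cast h)
  rw [hF] at hwt
  push_cast at hwt
  refine ⟨⟨hval, v1, v2, v3, v4, v5, v6⟩, ⟨hbij.1, hbij.2, fun α β γ => ?_⟩, ?_, ?_, ?_, ?_, ?_,
    ?_, ?_⟩
  · have h := hwt α β γ
    rw [hQ] at h
    have h' := congrArg (Int.cast : ℤ → ℚ) h
    push_cast at h'
    linarith
  · intro c hc
    obtain ⟨t, -, rfl⟩ := hbij.2.surjOn hc
    have h := hwt t.1 t.2.1 t.2.2
    have hv := hval t.1 t.2.1 t.2.2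
    rw [hM₁, hM₃, hQ] at hv
    rw [hQ] at h
    simp only [Set.mem_insert_iff, Set.mem_singleton_iff] at hv ⊢
    generalize (2 : ℤ) ^ (n - 1) = Q at *
    generalize (2 : ℤ) ^ ((n + d - 2) / 2) = M₁ at *
    generalize (2 : ℤ) ^ ((n + 3 * d - 2) / 2) = M₃ at *
    omega
  · rw [← v1, hmult (2 ^ ((n + d) / 2)) _ (by rw [hM₁, hQ]; ring)]
  · rw [← v2, hmult (-2 ^ ((n + d) / 2)) _ (by rw [hM₁, hQ]; ring)]
  · rw [← v3, hmult (2 ^ ((n + 3 * d) / 2)) _ (by rw [hM₃, hQ]; ring)]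
  · rw [← v4, hmult (-2 ^ ((n + 3 * d) / 2)) _ (by rw [hM₃, hQ]; ring)]
  · rw [← v5, hmult 0 _ (by rw [hQ]; ring)]
  · exact (hmult (2 ^ n) 0 (by ring)).trans v6
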